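/- **Setting.** Let $K$ be a non-archimedean local field of characteristic $p>0$ with ring of integers $\mathcal O$, prime element $\mathfrak p$, residue field $\mathcal O/\mathfrak p\mathcal O$ of order $q=p^c$, and Haar measure $|\cdot|$ on $K^+$ with $|\mathcal O|=1$. Fix $1=\epsilon_0,\epsilon_1,\dots,\epsilon_{c-1}\in\mathcal O$ whose residue classes form a basis of $\mathcal O/\mathfrak p\mathcal O$ over $GF(p)$. For $0\le n<q$, $n=\sum_{i<c}a_ip^i$ with $0\le a_i<p$, put $u(n)=\big(\sum_{i<c}a_i\epsilon_i\big)\mathfrak p^{-1}$; for $n=\sum_{k}b_kq^k$ with $0\le b_k<q$, put $u(n)=\sum_k u(b_k)\mathfrak p^{-k}$. Fix a continuous unitary character $\chi$ of $K^+$ that is trivial on $\mathcal O$ and nontrivial on $\mathfrak p^{-1}\mathcal O$, and normalized so that $\chi(u(k)u(l))=1$ for all $k,l\in\mathbb N_0$. Let $\widehat f$ denote the continuous extension to $L^2(K)$ of the Fourier transform $\widehat f(\xi)=\int_K f(x)\chi(-\xi x)\,dx$ on $L^1(K)\cap L^2(K)$. Put $D^jf(x)=q^{j/2}f(\mathfrak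 p^{-j}x)$ for $j\in\mathbb Z$ and $T_kf(x)=f(x-u(k))$ for $k\in\mathbb N_0$. A finite family $\Psi=\{\psi_1,\dots,\psi_L\}\subset L^2(K)$ is a *Parseval multiwavelet* if $$\sum_{m=1}^L\sum_{j\in\mathbb Z}\sum_{k\in\mathbb N_0}|\langle f,D^jT_k\psi_m\rangle|^2=\|f\|^2\qquad\text{for all } f\in L^2(K).$$ A countable family of measurable sets is a *measurable partition* of $S\subseteq K$ if any two members with distinct indices intersect in a null set and the union of all members differs from $S$ by a null set. **Proposition 4.1.** Let $\Psi=\{\psi_m\}_{m=1}^L\subset L^2(K)$ be such that $|\widehat\psi_m|=\chi_{W_m}$ a.e. for measurable sets $W_m\subseteq K$ (here $\chi_{W_m}$ is the indicator function), $1\le m\le L$, and let $W=\bigcup_{m=1}^LW_m$. Then $\Psi$ is a Parseval multiwavelet if and only if the following hold: (i) the union $W=\bigcup_{m=1}^L W_m$ is disjoint up to null sets, i.e. $|W_m\cap W_{m'}|=0$ for $m\ne m'$, and $\{\mathfrak p^jW: j\in\mathbb Z\}$ is a measurable partition of $K$; (ii) for each $m\in\{1,\dots,L\}$, $\{W_m+u(k):k\in\mathbb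 N_0\}$ is a measurable partition of a measurable subset of $K$. In this case, $|\mathfrak p^jW_m\cap W_{m'}|=0$ for all $j\in\mathbb Z$ and all $m,m'\in\{1,\dots,L\}$ with $m\neq m'$. -/

import Mathlib

open MeasureTheory Filter Topology ValuativeRel
open scoped ENNReal

noncomputable section

namespace LFPC

section Translations

variable (K : Type*) [Field K] [ValuativeRel K] [TopologicalSpace K] [IsNonarchimedeanLocalField K]

/-- The number `q` of elements of the residue field of the local field `K`. -/
def resCard : ℕ := Nat.card 𝓀[K]

/-- The residue field of a local field of characteristic `p` has characteristic `p`. -/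
theorem charP_residueField (p : ℕ) [hp : Fact p.Prime] [CharP K p] : CharP 𝓀[K] p := by
  refine (CharP.charP_iff_prime_eq_zero hp.out).2 ?_
  have h : ((p : ℕ) : 𝒪[K]) = 0 := by
    apply Subtype.ext
    simp
  have h' := congrArg (IsLocalRing.residue 𝒪[K]) h
  rwa [map_natCast, map_zero] at h'

variable {K}

/-- The residue classes of `ε 0, …, ε (c - 1)` form a basis of the residue field, as a vector
space over the field with `p` elements. -/
def IsResidueBasis (p : ℕ) [Fact p.Prime] [CharP K p] {c : ℕ} (ε : Fin c → 𝒪[K]) : Prop :=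
  haveI := charP_residueField K p
  letI : Algebra (ZMod p) 𝓀[K] := ZMod.algebra 𝓀[K] p
  LinearIndependent (ZMod p) (fun i => IsLocalRing.residue 𝒪[K] (ε i)) ∧
    Submodule.span (ZMod p) (Set.range fun i => IsLocalRing.residue 𝒪[K] (ε i)) = ⊤

/-- For `0 ≤ n < q = p ^ c` with base `p` expansion `n = ∑ i, a i * p ^ i`, this is
`u(n) = (∑ i, a i * ε i) * ϖ⁻¹`. -/
def uDigit (p : ℕ) {c : ℕ} (ϖ : 𝒪[K]) (ε : Fin c → 𝒪[K]) (n : ℕ) : K :=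
  (∑ i : Fin c, ((n / p ^ (i : ℕ) % p : ℕ) : K) * (ε i : K)) * (ϖ : K)⁻¹

/-- For `n` with base `q` expansion `n = ∑ k, b k * q ^ k`, this is
`u(n) = ∑ k, u(b k) * ϖ ^ (-k)`; the digits `b k` with `k ≥ n` vanish, since `n < q ^ n`, so that
the sum over `k < n` contains all nonzero terms. -/
def u (p : ℕ) {c : ℕ} (ϖ : 𝒪[K]) (ε : Fin c → 𝒪[K]) (n : ℕ) : K :=
  ∑ k ∈ Finset.range n, uDigit p ϖ ε (n / resCard K ^ k % resCard K) * (ϖ : K) ^ (-(k : ℤ))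

/-- The fixed character of `K⁺`: a continuous unitary character of the additive group of `K` that
is trivial on the ring of integers, nontrivial on `ϖ⁻¹ 𝒪`, and normalized in such a way that
`χ (u k * u l) = 1` for all `k` and `l`. -/
structure IsNormalizedCharacter (p : ℕ) {c : ℕ} (ϖ : 𝒪[K]) (ε : Fin c → 𝒪[K])
    (χ : AddChar K Circle) : Prop where
  continuous : Continuous χ
  trivial_on_integers : ∀ x : 𝒪[K], χ (x : K) = 1
  nontrivial_on_inverse : ∃ x : 𝒪[K], χ ((ϖ : K)⁻¹ * (x : K)) ≠ 1
  trivial_on_mul : ∀ k l : ℕ, χ (u p ϖ ε k * u p ϖ ε l) = 1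

/-- The translation operator `(T_k f)(x) = f (x - u k)`. -/
def translate (p : ℕ) {c : ℕ} (ϖ : 𝒪[K]) (ε : Fin c → 𝒪[K]) (k : ℕ) (f : K → ℂ) : K → ℂ :=
  fun x => f (x - u p ϖ ε k)

/-- The dilation operator `(D^j f)(x) = q ^ (j / 2) * f (ϖ ^ (-j) * x)`. -/
def dilate (ϖ : 𝒪[K]) (j : ℤ) (f : K → ℂ) : K → ℂ :=
  fun x => (((resCard K : ℝ) ^ ((j : ℝ) / 2) : ℝ) : ℂ) * f ((ϖ : K) ^ (-j) * x)

variable [MeasurableSpace K]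

/-- `Ψ = (ψ m)` is a Parseval multiwavelet: the affine system `D^j T_k (ψ m)` is a Parseval frame
for `L²(K)`, i.e. `∑_{m, j, k} |⟨f, D^j T_k (ψ m)⟩|² = ‖f‖²` for all `f` in `L²(K)`, where the inner
product is written out as an integral (of a product of two square integrable functions). -/
def IsParsevalMultiwavelet (μ : Measure K) (p : ℕ) {c : ℕ} (ϖ : 𝒪[K]) (ε : Fin c → 𝒪[K]) {L : ℕ}
    (ψ : Fin L → Lp ℂ 2 μ) : Prop :=
  ∀ f : Lp ℂ 2 μ,
    HasSum (fun i : Fin L × ℤ × ℕ =>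
      ‖∫ x, f x * (starRingEnd ℂ) (dilate ϖ i.2.1 (translate p ϖ ε i.2.2 (ψ i.1)) x) ∂μ‖ ^ 2)
      (‖f‖ ^ 2)

end Translations

section Fourier

variable {K : Type*} [Field K] [MeasurableSpace K]

/-- The graph of the Fourier transform `f ↦ (ξ ↦ ∫ f(x) χ(- ξ x) dx)` on `L¹(K) ∩ L²(K)`. -/
def fourierGraph (χ : AddChar K Circle) (μ : Measure K) : Set (Lp ℂ 2 μ × Lp ℂ 2 μ) :=
  {z | Integrable z.1 μ ∧ z.2 =ᵐ[μ] Fourier.fourierIntegral χ μ z.1}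

/-- `g` is the Fourier transform of `f` in `L²(K)`: the continuous extension to `L²(K)` of the
Fourier transform on `L¹(K) ∩ L²(K)`, i.e. `f` is a limit in `L²` of integrable functions whose
Fourier transforms converge in `L²` to `g`. -/
def IsL2Fourier (χ : AddChar K Circle) (μ : Measure K) (f g : Lp ℂ 2 μ) : Prop :=
  (f, g) ∈ closure (fourierGraph χ μ)

end Fourier

/-- A family of measurable sets is a measurable partition of `S` if its members are pairwise
disjoint and its union is `S`, both up to sets of measure zero. -/
def IsMeasurablePartition {X ι : Type*} [MeasurableSpace X] (μ : Measure X) (A : ι → Set X)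
    (S : Set X) : Prop :=
  (∀ i, MeasurableSet (A i)) ∧ (∀ i i', i ≠ i' → μ (A i ∩ A i') = 0) ∧ (⋃ i, A i) =ᵐ[μ] S

/-- The dilate `ϖ ^ j * S` of a set. -/
def dilateSet {K : Type*} [Field K] (ϖ : K) (j : ℤ) (S : Set K) : Set K :=
  (fun x => ϖ ^ j * x) '' S

/-- The translate `S + a` of a set. -/
def translateSet {K : Type*} [Field K] (a : K) (S : Set K) : Set K :=
  (fun x => x + a) '' S

end LFPC

end

set_option linter.unusedSectionVars false
set_option linter.style.haveILetI false

/-! The Fourier transform is unitary, and it turns `D^j T_k ψ` into `q^(-j/2) χ(-u(k) ϖ^j ξ) θ(ϖ^j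
ξ)`, where `θ` is the transform of `ψ`. After Plancherel and the substitution `η = ϖ^j ξ`, the
coefficients at scale `j` of a function with transform `g` are the integrals of `F(η) χ(u(k) η)`,
where `F(η) = q^(j/2) g(ϖ^(-j) η) conj (θ η)` (`IsCharLattice.inner_affineLp`).

The points `u(k)` represent `K / 𝒪`, and `χ(u(k) u(l)) = 1`. Hence the characters `χ(u(k) ·)` are
invariant under translation by every `u(l)`, and they restrict to an orthonormal basis of `L²(𝒪)`.
The integrals are therefore the Fourier coefficients of the periodization of `F`. When the
translates of `F` have disjoint supports there are no cross terms, and the sum over `k` of the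
squared coefficients is `‖F‖²`, which is the integral of `|g|²` over `ϖ^(-j) W m`
(`IsCharLattice.tsum_freqCoeff`).

If (ii) holds, the supports are disjoint for every `g`, and (i) says that the sets `ϖ^(-j) W m` tile
`K`, so the integrals add up to `‖g‖²`.

Conversely, three kinds of test function extract the conditions. A `g` supported off all the sets
`ϖ^(-j) W m` has only zero coefficients, so these sets cover `K`. The indicator of a piece `E` of an
overlap of two of them, inside a small enough ball, has no cross terms at either scale; it would
give `2 μ(E) ≤ μ(E)`, so the sets are disjoint. Finally, if `E` and `E + s` both lie in `W m`, where
`s` is a difference of two lattice points outside `𝒪`, then `θ` on `E` minus `θ` on `E + s` is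
orthogonal to the whole system, because the characters do not see `s`; so `E` is null. -/

namespace LFPC

/-! ### The points `u(k)` as representatives of `K / 𝒪`. -/

section Representatives

variable {K : Type*} [Field K] [ValuativeRel K] [TopologicalSpace K] [IsNonarchimedeanLocalField K]

theorem one_lt_resCard : 1 < resCard K :=
  Finite.one_lt_card

theorem ϖ_ne_zero {ϖ : 𝒪[K]} (hϖ : Irreducible ϖ) : (ϖ : K) ≠ 0 := by
  simpa using hϖ.ne_zero

theorem inv_not_mem_integer {ϖ : 𝒪[K]} (hϖ : Irreducible ϖ) : (ϖ : K)⁻¹ ∉ 𝒪[K] := by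
  intro h
  apply hϖ.not_isUnit
  refine IsUnit.of_mul_eq_one ⟨_, h⟩ ?_
  ext
  simp [mul_inv_cancel₀ (ϖ_ne_zero hϖ)]

theorem residue_eq_zero_iff_inv_mul_mem {ϖ : 𝒪[K]} (hϖ : Irreducible ϖ) (x : 𝒪[K]) :
    IsLocalRing.residue 𝒪[K] x = 0 ↔ (ϖ : K)⁻¹ * x ∈ 𝒪[K] := by
  rw [IsLocalRing.residue_eq_zero_iff, hϖ.maximalIdeal_eq, Ideal.mem_span_singleton]
  constructor
  · rintro ⟨y, rfl⟩
    simp [inv_mul_cancel_left₀ (ϖ_ne_zero hϖ)]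
  · intro h
    refine ⟨⟨_, h⟩, ?_⟩
    ext
    simp [mul_inv_cancel_left₀ (ϖ_ne_zero hϖ)]

theorem exists_pow_mul_mem_integer {ϖ : 𝒪[K]} (hϖ : Irreducible ϖ) (x : K) :
    ∃ n : ℕ, (ϖ : K) ^ n * x ∈ 𝒪[K] := by
  by_cases hx : x ∈ 𝒪[K]
  · exact ⟨0, by simpa using hx⟩
  have hx' : ¬ valuation K x ≤ 1 := hx
  have hx0 : x ≠ 0 := by rintro rfl; exact hx (zero_mem _)
  have hi : x⁻¹ ∈ 𝒪[K] := by
    change valuation K x⁻¹ ≤ 1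
    rw [map_inv₀]
    exact inv_le_one_of_one_le₀ (not_le.1 hx').le
  obtain ⟨n, hn⟩ := IsDiscreteValuationRing.associated_pow_irreducible
    (x := (⟨x⁻¹, hi⟩ : 𝒪[K])) (by simpa [Subtype.ext_iff] using hx0) hϖ
  obtain ⟨y, hy⟩ := hn.dvd
  refine ⟨n, ?_⟩
  have hy' := congrArg Subtype.val hy
  simp only [SubmonoidClass.coe_pow, Subring.coe_mul] at hy'
  rw [hy', mul_comm x⁻¹, mul_assoc, inv_mul_cancel₀ hx0, mul_one]
  exact y.2

theorem resCard_eq_pow (p : ℕ) [Fact p.Prime] [CharP K p] {c : ℕ} {ε : Fin c → 𝒪[K]}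
    (hε : IsResidueBasis p ε) : resCard K = p ^ c := by
  haveI := charP_residueField K p
  letI : Algebra (ZMod p) 𝓀[K] := ZMod.algebra 𝓀[K] p
  obtain ⟨h1, h2⟩ := hε
  let b := Module.Basis.mk h1 h2.ge
  haveI := Fintype.ofFinite 𝓀[K]
  rw [resCard, Nat.card_eq_fintype_card, Module.card_eq_pow_finrank (K := ZMod p),
    Module.finrank_eq_card_basis b]
  simp [ZMod.card]

section Digits

variable (p : ℕ) {c : ℕ} (ϖ : 𝒪[K]) (ε : Fin c → 𝒪[K])

/-- The integral element `∑ i, a i * ε i` attached to `n = ∑ i, a i * p ^ i`. -/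
noncomputable def digitRep (n : ℕ) : 𝒪[K] :=
  ∑ i : Fin c, ((n / p ^ (i : ℕ) % p : ℕ) : 𝒪[K]) * ε i

theorem uDigit_eq (n : ℕ) : uDigit p ϖ ε n = (digitRep p ε n : K) * (ϖ : K)⁻¹ := by
  simp [uDigit, digitRep]

theorem uDigit_zero : uDigit p ϖ ε 0 = 0 := by
  simp [uDigit]

theorem u_zero : u p ϖ ε 0 = 0 := by
  simp [u]

theorem u_eq_sum_range {n N : ℕ} (h : n ≤ N) : u p ϖ ε n = ∑ k ∈ Finset.range N,
    uDigit p ϖ ε (n / resCard K ^ k % resCard K) * (ϖ : K) ^ (-(k : ℤ)) := by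
  refine Finset.sum_subset (by simpa using h) fun k _ hk => ?_
  have hk' : n < resCard K ^ k :=
    (le_of_not_gt (by simpa using hk) : n ≤ k).trans_lt (Nat.lt_pow_self one_lt_resCard)
  rw [Nat.div_eq_of_lt hk', Nat.zero_mod, uDigit_zero, zero_mul]

/-- Splitting off the lowest base `q` digit; the inductions on `u` below run through this recursion.
-/
theorem u_eq_uDigit_add (hϖ : (ϖ : K) ≠ 0) (n : ℕ) :
    u p ϖ ε n = uDigit p ϖ ε (n % resCard K) + (ϖ : K)⁻¹ * u p ϖ ε (n / resCard K) := by
  rw [u_eq_sum_range p ϖ ε (Nat.le_succ n), Finset.sum_range_succ',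
    u_eq_sum_range p ϖ ε (Nat.div_le_self n (resCard K)), Finset.mul_sum, add_comm]
  congr 1
  · simp
  · refine Finset.sum_congr rfl fun k _ => ?_
    rw [Nat.div_div_eq_div_mul, ← pow_succ', mul_left_comm]
    congr 1
    rw [Nat.cast_succ, neg_add, zpow_add₀ hϖ, zpow_neg_one, mul_comm]

end Digits

section ResidueBasis

variable {p : ℕ} [Fact p.Prime] [CharP K p] {c : ℕ} {ε : Fin c → 𝒪[K]}

theorem residue_digitRep (n : ℕ) :
    IsLocalRing.residue 𝒪[K] (digitRep p ε n) =
      ∑ i : Fin c, ((n / p ^ (i : ℕ) % p : ℕ) : 𝓀[K]) * IsLocalRing.residue 𝒪[K] (ε i) := by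
  simp [digitRep]

/-- Linear independence over `ZMod p` makes the base `p` digits agree, and the numbers are rebuilt
modulo `p ^ i` one digit at a time. Surjectivity onto the residue field then follows by counting. -/
theorem digitRep_residue_injective (hε : IsResidueBasis p ε) {m n : ℕ} (hm : m < resCard K)
    (hn : n < resCard K)
    (h : IsLocalRing.residue 𝒪[K] (digitRep p ε m) = IsLocalRing.residue 𝒪[K] (digitRep p ε n)) :
    m = n := by
  rw [resCard_eq_pow p hε] at hm hn
  haveI := charP_residueField K p
  letI : Algebra (ZMod p) 𝓀[K] := ZMod.algebra 𝓀[K] p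
  obtain ⟨h1, h2⟩ := hε
  rw [residue_digitRep, residue_digitRep] at h
  have key := Fintype.linearIndependent_iff.1 h1
    (fun i => ((m / p ^ (i : ℕ) % p : ℕ) : ZMod p) - ((n / p ^ (i : ℕ) % p : ℕ) : ZMod p)) (by
      simp only [Algebra.smul_def, map_sub, map_natCast, sub_mul, Finset.sum_sub_distrib]
      rw [h, sub_self])
  have hp : 1 < p := (Fact.out : p.Prime).one_lt
  have hd : ∀ i < c, m / p ^ i % p = n / p ^ i % p := by
    intro i hi
    have := sub_eq_zero.1 (key ⟨i, hi⟩)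
    rw [ZMod.natCast_eq_natCast_iff] at this
    simpa [Nat.ModEq] using this
  have : ∀ i ≤ c, m % p ^ i = n % p ^ i := by
    intro i
    induction i with
    | zero => simp [Nat.mod_one]
    | succ i ih =>
      intro hi
      rw [Nat.mod_pow_succ, Nat.mod_pow_succ, ih (by omega), hd i (by omega)]
  have := this c le_rfl
  rwa [Nat.mod_eq_of_lt hm, Nat.mod_eq_of_lt hn] at this

theorem exists_residue_digitRep (hε : IsResidueBasis p ε) (x : 𝒪[K]) :
    ∃ n < resCard K, IsLocalRing.residue 𝒪[K] (digitRep p ε n) = IsLocalRing.residue 𝒪[K] x := by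
  haveI := Fintype.ofFinite 𝓀[K]
  let f : Fin (resCard K) → 𝓀[K] := fun n => IsLocalRing.residue 𝒪[K] (digitRep p ε n)
  have hf : Function.Injective f := fun m n h =>
    Fin.ext (digitRep_residue_injective hε m.2 n.2 h)
  have := (Fintype.bijective_iff_injective_and_card f).2
    ⟨hf, by simp [resCard, Nat.card_eq_fintype_card]⟩
  obtain ⟨n, hn⟩ := this.2 (IsLocalRing.residue 𝒪[K] x)
  exact ⟨n, n.2, hn⟩

theorem u_add_mul (ϖ : 𝒪[K]) (hϖ : (ϖ : K) ≠ 0) {b : ℕ} (hb : b < resCard K) (k : ℕ) :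
    u p ϖ ε (b + resCard K * k) = uDigit p ϖ ε b + (ϖ : K)⁻¹ * u p ϖ ε k := by
  rw [u_eq_uDigit_add p ϖ ε hϖ, Nat.add_mul_mod_self_left, Nat.mod_eq_of_lt hb,
    Nat.add_mul_div_left _ _ (by omega), Nat.div_eq_of_lt hb, zero_add]

theorem mul_uDigit_mem {ϖ : 𝒪[K]} (hϖ : Irreducible ϖ) (n : ℕ) :
    (ϖ : K) * uDigit p ϖ ε n ∈ 𝒪[K] := by
  rw [uDigit_eq, mul_left_comm, mul_inv_cancel₀ (ϖ_ne_zero hϖ), mul_one]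
  exact (digitRep p ε n).2

/-- The induction approximates `ϖ * x` by some `u(k)`; the residue of the integral remainder is the
new lowest digit. The bound on `k` matters for `n = 1`, where it counts the cosets of `𝒪` in `ϖ⁻¹
𝒪`. -/
theorem exists_lt_pow_sub_u_mem {ϖ : 𝒪[K]} (hϖ : Irreducible ϖ) (hε : IsResidueBasis p ε) (n : ℕ)
    (x : K) (hx : (ϖ : K) ^ n * x ∈ 𝒪[K]) : ∃ k, k < resCard K ^ n ∧ x - u p ϖ ε k ∈ 𝒪[K] := by
  induction n generalizing x with
  | zero => exact ⟨0, by simp, by simpa [u_zero] using hx⟩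
  | succ n ih =>
    obtain ⟨k, hk, hkx⟩ := ih ((ϖ : K) * x) (by rwa [← mul_assoc, ← pow_succ])
    obtain ⟨b, hb, hbx⟩ := exists_residue_digitRep hε ⟨_, hkx⟩
    refine ⟨b + resCard K * k, ?_, ?_⟩
    · calc b + resCard K * k < resCard K + resCard K * k := by omega
        _ = resCard K * (k + 1) := by ring
        _ ≤ resCard K * resCard K ^ n := Nat.mul_le_mul_left _ hk
        _ = _ := by ring
    · rw [eq_comm, ← sub_eq_zero, ← map_sub, residue_eq_zero_iff_inv_mul_mem hϖ] at hbx
      rw [u_add_mul ϖ (ϖ_ne_zero hϖ) hb, uDigit_eq]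
      convert hbx using 1
      have := ϖ_ne_zero hϖ
      simp only [AddSubgroupClass.coe_sub]
      field_simp
      ring

theorem exists_sub_u_mem {ϖ : 𝒪[K]} (hϖ : Irreducible ϖ) (hε : IsResidueBasis p ε) (x : K) :
    ∃ k, x - u p ϖ ε k ∈ 𝒪[K] := by
  obtain ⟨n, hn⟩ := exists_pow_mul_mem_integer hϖ x
  obtain ⟨k, -, hk⟩ := exists_lt_pow_sub_u_mem hϖ hε n x hn
  exact ⟨k, hk⟩

theorem eq_of_u_sub_u_mem {ϖ : 𝒪[K]} (hϖ : Irreducible ϖ) (hε : IsResidueBasis p ε) (k l : ℕ)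
    (h : u p ϖ ε k - u p ϖ ε l ∈ 𝒪[K]) : k = l := by
  have h0 := ϖ_ne_zero hϖ
  have hq := one_lt_resCard (K := K)
  induction hs : k + l using Nat.strong_induction_on generalizing k l with
  | _ s ih =>
    -- Multiplication by `ϖ` makes the lowest digits integral, so only the shifted expansions remain
    -- modulo `𝒪`.
    have key : u p ϖ ε (k / resCard K) - u p ϖ ε (l / resCard K) ∈ 𝒪[K] := by
      have h1 := sub_mem (mul_mem ϖ.2 h) (sub_mem (mul_uDigit_mem (p := p) (ε := ε) hϖ
        (k % resCard K)) (mul_uDigit_mem (p := p) (ε := ε) hϖ (l % resCard K)))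
      convert h1 using 1
      rw [u_eq_uDigit_add p ϖ ε h0 k, u_eq_uDigit_add p ϖ ε h0 l]
      field_simp
      ring
    have hdiv : k / resCard K = l / resCard K := by
      rcases Nat.eq_zero_or_pos s with h | h
      · rw [show k = 0 by omega, show l = 0 by omega]
      · refine ih _ ?_ _ _ key rfl
        have hk := Nat.div_le_self k (resCard K)
        have hl := Nat.div_le_self l (resCard K)
        rcases Nat.eq_zero_or_pos k with h' | h'
        · have := Nat.div_lt_self (show 0 < l by omega) hq
          omega
        · have := Nat.div_lt_self h' hq
          omega
    have hmod : k % resCard K = l % resCard K := by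
      refine digitRep_residue_injective hε (Nat.mod_lt _ (by omega)) (Nat.mod_lt _ (by omega)) ?_
      rw [← sub_eq_zero, ← map_sub, residue_eq_zero_iff_inv_mul_mem hϖ]
      rw [u_eq_uDigit_add p ϖ ε h0 k, u_eq_uDigit_add p ϖ ε h0 l, hdiv, uDigit_eq, uDigit_eq] at h
      convert h using 1
      simp only [AddSubgroupClass.coe_sub]
      ring
    rw [← Nat.div_add_mod k (resCard K), ← Nat.div_add_mod l (resCard K), hdiv, hmod]

end ResidueBasis

end Representatives

/-! ### The self-dual system of representatives, and the topology given by balls. -/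

section Lattice

variable {K : Type*} [Field K] [ValuativeRel K] [TopologicalSpace K] [IsNonarchimedeanLocalField K]

/-- A system `v` of representatives of `K / 𝒪` which is isotropic for the pairing
`(x, y) ↦ χ (x * y)`, where `𝒪` is its own annihilator. -/
structure IsCharLattice (χ : AddChar K Circle) (v : ℕ → K) : Prop where
  continuous : Continuous χ
  map_integer : ∀ x ∈ 𝒪[K], χ x = 1
  mem_integer : ∀ y : K, (∀ x ∈ 𝒪[K], χ (y * x) = 1) → y ∈ 𝒪[K]
  zero : v 0 = 0
  exists_sub_mem : ∀ x, ∃ k, x - v k ∈ 𝒪[K]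
  eq_of_sub_mem : ∀ k l, v k - v l ∈ 𝒪[K] → k = l
  map_mul_eq_one : ∀ k l, χ (v k * v l) = 1

theorem isCharLattice_u {p : ℕ} [Fact p.Prime] [CharP K p] {c : ℕ} {ϖ : 𝒪[K]} {ε : Fin c → 𝒪[K]}
    (hϖ : Irreducible ϖ) (hε : IsResidueBasis p ε) {χ : AddChar K Circle}
    (hχ : IsNormalizedCharacter p ϖ ε χ) : IsCharLattice χ (u p ϖ ε) where
  continuous := hχ.continuous
  map_integer x hx := hχ.trivial_on_integers ⟨x, hx⟩
  -- If `y ∉ 𝒪`, then `y⁻¹` lies in the maximal ideal, so `ϖ⁻¹ y⁻¹ x` is integral. Multiplied by `y`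
  -- it becomes `ϖ⁻¹ x`, where `χ` is not trivial.
  mem_integer y hy := by
    by_contra h
    obtain ⟨x, hx⟩ := hχ.nontrivial_on_inverse
    apply hx
    have hy0 : y ≠ 0 := by rintro rfl; exact h (zero_mem _)
    have hinv : y⁻¹ ∈ 𝒪[K] := by
      change valuation K y⁻¹ ≤ 1
      rw [map_inv₀]
      exact inv_le_one_of_one_le₀ (not_le.1 h).le
    have hnu : (⟨y⁻¹, hinv⟩ : 𝒪[K]) ∈ IsLocalRing.maximalIdeal 𝒪[K] := by
      rw [IsLocalRing.mem_maximalIdeal, mem_nonunits_iff]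
      intro hu
      obtain ⟨z, hz⟩ := hu.exists_right_inv
      apply h
      have := congrArg Subtype.val hz
      simp only [Subring.coe_mul, Subring.coe_one] at this
      rw [inv_mul_eq_one₀ hy0] at this
      rw [this]
      exact z.2
    rw [← IsLocalRing.residue_eq_zero_iff, residue_eq_zero_iff_inv_mul_mem hϖ] at hnu
    have := hy _ (mul_mem hnu x.2)
    have he : y * ((ϖ : K)⁻¹ * y⁻¹ * x) = (ϖ : K)⁻¹ * x := by field_simp
    rwa [he] at this
  zero := u_zero p ϖ ε
  exists_sub_mem := exists_sub_u_mem hϖ hε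
  eq_of_sub_mem := eq_of_u_sub_u_mem hϖ hε
  map_mul_eq_one := hχ.trivial_on_mul

theorem isOpen_integer : IsOpen (𝒪[K] : Set K) := Valuation.isOpen_integer

theorem isCompact_integer : IsCompact (𝒪[K] : Set K) :=
  isCompact_iff_compactSpace.mpr (inferInstanceAs (CompactSpace 𝒪[K]))

/-- The set of all `x` with `a * x - b ∈ 𝒪`. -/
def ballAt (a b : K) : Set K := {x | a * x - b ∈ 𝒪[K]}

theorem mem_ballAt {a b x : K} : x ∈ ballAt a b ↔ a * x - b ∈ 𝒪[K] := Iff.rfl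

theorem isOpen_ballAt (a b : K) : IsOpen (ballAt a b) :=
  isOpen_integer.preimage (by fun_prop : Continuous fun x => a * x - b)

theorem exists_ballAt_subset {ϖ : 𝒪[K]} (hϖ : Irreducible ϖ) {s : Set K} {x : K} (hs : s ∈ 𝓝 x) :
    ∃ n : ℕ, ∀ b, x ∈ ballAt ((ϖ : K)⁻¹ ^ n) b → ballAt ((ϖ : K)⁻¹ ^ n) b ⊆ s := by
  obtain ⟨γ, hγ⟩ := IsValuativeTopology.mem_nhds_iff.1 hs
  obtain ⟨r, hr⟩ := ValuativeRel.valuation_surjective (γ : ValueGroupWithZero K)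
  have hr0 : r ≠ 0 := by rintro rfl; exact γ.ne_zero (by simpa using hr.symm)
  obtain ⟨n, hn⟩ := exists_pow_mul_mem_integer hϖ r⁻¹
  have h0 := ϖ_ne_zero hϖ
  -- The exponent `n` reaches valuation at most `γ`; the extra factor `ϖ` makes the inequality
  -- strict.
  refine ⟨n + 1, fun b hx y hy => hγ ⟨y - x, ?_, by simp⟩⟩
  have hlt : valuation K (ϖ : K) < 1 := by
    by_contra h
    refine inv_not_mem_integer hϖ ?_
    change valuation K (ϖ : K)⁻¹ ≤ 1
    rw [map_inv₀]
    exact inv_le_one_of_one_le₀ (not_lt.1 h)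
  have h1 : valuation K (((ϖ : K)⁻¹ ^ (n + 1)) * (y - x)) ≤ 1 := by
    have := sub_mem (mem_ballAt.1 hy) (mem_ballAt.1 hx)
    rw [sub_sub_sub_cancel_right, ← mul_sub] at this
    exact this
  have h2 : y - x = (ϖ : K) * r * ((ϖ : K) ^ n * r⁻¹) * (((ϖ : K)⁻¹ ^ (n + 1)) * (y - x)) := by
    rw [inv_pow, pow_succ]
    field_simp
  change valuation K (y - x) < γ
  rw [h2, ← hr]
  simp only [map_mul _ _ (((ϖ : K)⁻¹ ^ (n + 1)) * (y - x)), map_mul _ _ ((ϖ : K) ^ n * r⁻¹),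
    map_mul _ _ r]
  have hr1 : 0 < valuation K r := by simpa [zero_lt_iff] using hr0
  calc _ ≤ valuation K ϖ * valuation K r * 1 * 1 := by gcongr; exact hn
    _ < 1 * valuation K r := by rw [mul_one, mul_one]; gcongr
    _ = _ := one_mul _

theorem isTopologicalBasis_ballAt {ϖ : 𝒪[K]} (hϖ : Irreducible ϖ) {v : ℕ → K}
    (hv : ∀ x, ∃ k, x - v k ∈ 𝒪[K]) :
    TopologicalSpace.IsTopologicalBasis
      (Set.range fun i : ℕ × ℕ => ballAt ((ϖ : K)⁻¹ ^ i.1) (v i.2)) := by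
  refine TopologicalSpace.isTopologicalBasis_of_isOpen_of_nhds ?_ fun x s hx hs => ?_
  · rintro _ ⟨i, rfl⟩
    exact isOpen_ballAt _ _
  · obtain ⟨n, hn⟩ := exists_ballAt_subset hϖ (hs.mem_nhds hx)
    obtain ⟨k, hk⟩ := hv ((ϖ : K)⁻¹ ^ n * x)
    exact ⟨_, ⟨(n, k), rfl⟩, hk, hn _ hk⟩

theorem secondCountableTopology {ϖ : 𝒪[K]} (hϖ : Irreducible ϖ) {v : ℕ → K}
    (hv : ∀ x, ∃ k, x - v k ∈ 𝒪[K]) : SecondCountableTopology K :=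
  (isTopologicalBasis_ballAt hϖ hv).secondCountableTopology (Set.countable_range _)

/-- Two ultrametric balls that meet are nested. -/
theorem isPiSystem_ballAt {ϖ : 𝒪[K]} (hϖ : Irreducible ϖ) (v : ℕ → K) :
    IsPiSystem (Set.range fun i : ℕ × ℕ => ballAt ((ϖ : K)⁻¹ ^ i.1) (v i.2)) := by
  have key : ∀ m n : ℕ, m ≤ n → ∀ b b' x, x ∈ ballAt ((ϖ : K)⁻¹ ^ m) b →
      x ∈ ballAt ((ϖ : K)⁻¹ ^ n) b' →
        ballAt ((ϖ : K)⁻¹ ^ n) b' ⊆ ballAt ((ϖ : K)⁻¹ ^ m) b := by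
    intro m n hmn b b' x hx hx' y hy
    obtain ⟨d, rfl⟩ := Nat.exists_eq_add_of_le hmn
    have h0 := ϖ_ne_zero hϖ
    have := add_mem (mul_mem (pow_mem ϖ.2 d) (sub_mem (mem_ballAt.1 hy) (mem_ballAt.1 hx')))
      (mem_ballAt.1 hx)
    rw [mem_ballAt]
    convert this using 1
    rw [inv_pow, inv_pow, pow_add]
    field_simp
    ring
  rintro _ ⟨⟨m, k⟩, rfl⟩ _ ⟨⟨n, l⟩, rfl⟩ ⟨x, hx, hx'⟩
  rcases le_total m n with h | h
  · exact ⟨(n, l), (Set.inter_eq_right.2 (key m n h _ _ x hx hx')).symm⟩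
  · exact ⟨(m, k), (Set.inter_eq_left.2 (key n m h _ _ x hx' hx)).symm⟩

/-! ### Scaling of Haar measure. -/

variable [MeasurableSpace K] [BorelSpace K] (μ : Measure K) [μ.IsAddHaarMeasure]

theorem measurableSet_integer : MeasurableSet (𝒪[K] : Set K) := isOpen_integer.measurableSet

theorem measurableSet_ballAt (a b : K) : MeasurableSet (ballAt a b) :=
  (isOpen_ballAt a b).measurableSet

theorem measure_preimage_mul_integer {p : ℕ} [Fact p.Prime] [CharP K p] {c : ℕ} {ϖ : 𝒪[K]}
    {ε : Fin c → 𝒪[K]} (hϖ : Irreducible ϖ) (hε : IsResidueBasis p ε)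
    (hμ : μ (𝒪[K] : Set K) = 1) : μ ((fun x => (ϖ : K) * x) ⁻¹' 𝒪[K]) = resCard K := by
  have h0 := ϖ_ne_zero hϖ
  have : (fun x => (ϖ : K) * x) ⁻¹' (𝒪[K] : Set K) =
      ⋃ k ∈ Finset.range (resCard K), (fun x => x - u p ϖ ε k) ⁻¹' (𝒪[K] : Set K) := by
    ext x
    simp only [Set.mem_preimage, SetLike.mem_coe, Set.mem_iUnion, Finset.mem_range, exists_prop]
    constructor
    · intro hx
      simpa using exists_lt_pow_sub_u_mem hϖ hε 1 x (by simpa using hx)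
    · rintro ⟨k, hk, hx⟩
      have hu : u p ϖ ε k = uDigit p ϖ ε k := by simpa [u_zero] using u_add_mul (p := p) (ε := ε) ϖ h0 hk 0
      have := add_mem (mul_mem ϖ.2 hx) (mul_uDigit_mem (p := p) (ε := ε) hϖ k)
      rw [← hu] at this
      convert this using 1
      ring
  rw [this, measure_biUnion_finset]
  · simp_rw [sub_eq_add_neg, measure_preimage_add_right, hμ]
    simp
  · intro k _ l _ hkl
    refine Set.disjoint_left.2 fun x hx hx' => hkl ?_
    refine eq_of_u_sub_u_mem hϖ hε k l ?_
    have := sub_mem (show x - u p ϖ ε l ∈ 𝒪[K] from hx') (show x - u p ϖ ε k ∈ 𝒪[K] from hx)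
    simpa using this
  · intro k _
    exact measurableSet_integer.preimage (by fun_prop)

/-- The image of `μ` under multiplication by `a` is `r • μ`. -/
def HasScale (μ : Measure K) (a : K) (r : ℝ≥0∞) : Prop := μ.map (fun x => a * x) = r • μ

/-- By uniqueness of Haar measure the image is a multiple of `μ`. The constant is read off on `𝒪`,
whose preimage `ϖ⁻¹ 𝒪` consists of `q` cosets of `𝒪`. -/
theorem hasScale_uniformizer [SecondCountableTopology K] {p : ℕ} [Fact p.Prime] [CharP K p] {c : ℕ}
    {ϖ : 𝒪[K]} {ε : Fin c → 𝒪[K]} (hϖ : Irreducible ϖ) (hε : IsResidueBasis p ε)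
    (hμ : μ (𝒪[K] : Set K) = 1) : HasScale μ (ϖ : K) (resCard K) := by
  let e := Homeomorph.mulLeft₀ (ϖ : K) (ϖ_ne_zero hϖ)
  have hmap : (μ.map (fun x => (ϖ : K) * x)).IsAddHaarMeasure :=
    Measure.isAddHaarMeasure_map μ (AddMonoidHom.mulLeft (ϖ : K)) e.continuous e.surjective
      e.isClosedEmbedding.tendsto_cocompact
  have h := Measure.isAddLeftInvariant_eq_smul (μ.map (fun x => (ϖ : K) * x)) μ
  generalize (μ.map (fun x => (ϖ : K) * x)).addHaarScalarFactor μ = r at h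
  have hO := congrArg (fun ν : Measure K => ν 𝒪[K]) h
  rw [Measure.smul_apply, hμ, ENNReal.smul_def, smul_eq_mul, mul_one] at hO
  rw [Measure.map_apply (by fun_prop) measurableSet_integer,
    measure_preimage_mul_integer μ hϖ hε hμ] at hO
  rw [HasScale, h, hO]
  rfl

variable {μ}

theorem HasScale.mul {a b : K} {r s : ℝ≥0∞} (ha : HasScale μ a r) (hb : HasScale μ b s) :
    HasScale μ (a * b) (r * s) := by
  have : (fun x => a * b * x) = (fun x => a * x) ∘ (fun x => b * x) := by
    ext; simp [mul_assoc]
  rw [HasScale, this, ← Measure.map_map (by fun_prop) (by fun_prop), hb, Measure.map_smul, ha,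
    smul_smul, mul_comm]

theorem HasScale.inv {a : K} {r : ℝ≥0∞} (ha : HasScale μ a r) (ha0 : a ≠ 0) (hr0 : r ≠ 0)
    (hr : r ≠ ⊤) : HasScale μ a⁻¹ r⁻¹ := by
  have h1 : Measure.map (fun x => a⁻¹ * x) (μ.map fun x => a * x) = μ := by
    rw [Measure.map_map (by fun_prop) (by fun_prop)]
    convert Measure.map_id using 2
    ext; simp [inv_mul_cancel_left₀ ha0]
  rw [ha, Measure.map_smul] at h1
  rw [HasScale]
  conv_rhs => rw [← h1]
  rw [smul_smul, ENNReal.inv_mul_cancel hr0 hr, one_smul]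

theorem HasScale.zpow {a : K} {r : ℝ≥0∞} (ha : HasScale μ a r) (ha0 : a ≠ 0) (hr0 : r ≠ 0)
    (hr : r ≠ ⊤) (j : ℤ) : HasScale μ (a ^ j) (r ^ j) := by
  induction j using Int.induction_on with
  | zero => simp [HasScale]
  | succ n ih =>
    rw [zpow_add₀ ha0, ENNReal.zpow_add hr0 hr, zpow_one, zpow_one]
    exact ih.mul ha
  | pred n ih =>
    rw [sub_eq_add_neg, zpow_add₀ ha0, ENNReal.zpow_add hr0 hr, zpow_neg_one, zpow_neg_one]
    exact ih.mul (ha.inv ha0 hr0 hr)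

theorem HasScale.lintegral_comp {a : K} {r : ℝ≥0∞} (ha : HasScale μ a r) (ha0 : a ≠ 0)
    (g : K → ℝ≥0∞) : ∫⁻ x, g (a * x) ∂μ = r * ∫⁻ x, g x ∂μ := by
  have := lintegral_map_equiv (μ := μ) g (Homeomorph.mulLeft₀ a ha0).toMeasurableEquiv
  change ∫⁻ x, g x ∂(μ.map (fun x => a * x)) = ∫⁻ x, g (a * x) ∂μ at this
  rw [← this, ha, lintegral_smul_measure, smul_eq_mul]

theorem HasScale.integral_comp {a : K} {r : ℝ≥0∞} (ha : HasScale μ a r) (ha0 : a ≠ 0)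
    (g : K → ℂ) : ∫ x, g (a * x) ∂μ = r.toReal • ∫ x, g x ∂μ := by
  have := integral_map_equiv (μ := μ) (Homeomorph.mulLeft₀ a ha0).toMeasurableEquiv g
  change ∫ x, g x ∂(μ.map (fun x => a * x)) = ∫ x, g (a * x) ∂μ at this
  rw [← this, ha, integral_smul_measure]

theorem HasScale.quasiMeasurePreserving {a : K} {r : ℝ≥0∞} (ha : HasScale μ a r) :
    Measure.QuasiMeasurePreserving (fun x => a * x) μ μ where
  measurable := by fun_prop
  absolutelyContinuous := by
    rw [show μ.map (fun x => a * x) = r • μ from ha]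
    exact Measure.smul_absolutelyContinuous

end Lattice

/-! ### Character integrals and injectivity of the Fourier transform on `L¹`. -/

section Gabor

variable {K : Type*} [Field K] [ValuativeRel K] [TopologicalSpace K] [IsNonarchimedeanLocalField K]
  [MeasurableSpace K] [BorelSpace K] {μ : Measure K} [μ.IsAddHaarMeasure]
  {χ : AddChar K Circle} {v w : ℕ → K}

/-- A unitary character, as a complex valued function. -/
noncomputable def cchar (χ : AddChar K Circle) : AddChar K ℂ := Circle.coeHom.compAddChar χ

theorem cchar_def (χ : AddChar K Circle) (x : K) : cchar χ x = (χ x : ℂ) := rfl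

theorem norm_cchar (χ : AddChar K Circle) (x : K) : ‖cchar χ x‖ = 1 := Circle.norm_coe _

theorem conj_cchar (χ : AddChar K Circle) (x : K) :
    (starRingEnd ℂ) (cchar χ x) = cchar χ (-x) := by
  rw [cchar_def, cchar_def, ← Circle.coe_inv_eq_conj, AddChar.map_neg_eq_inv]

theorem cchar_eq_one {x : K} : cchar χ x = 1 ↔ χ x = 1 := Circle.coe_eq_one

theorem IsCharLattice.continuous_cchar (hv : IsCharLattice χ v) : Continuous (cchar χ) :=
  continuous_subtype_val.comp hv.continuous

theorem IsCharLattice.cchar_integer (hv : IsCharLattice χ v) {x : K} (hx : x ∈ 𝒪[K]) :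
    cchar χ x = 1 := cchar_eq_one.2 (hv.map_integer x hx)

theorem IsCharLattice.cchar_mul (hv : IsCharLattice χ v) (k l : ℕ) :
    cchar χ (v k * v l) = 1 := cchar_eq_one.2 (hv.map_mul_eq_one k l)

/-- Needed because the Fourier transform turns position `t` into frequency `-t`, and `-v k` need not
be of the form `v l`. -/
theorem IsCharLattice.neg (hv : IsCharLattice χ v) : IsCharLattice χ (fun k => -v k) where
  continuous := hv.continuous
  map_integer := hv.map_integer
  mem_integer := hv.mem_integer
  zero := by simp [hv.zero]
  exists_sub_mem x := by
    obtain ⟨k, hk⟩ := hv.exists_sub_mem (-x)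
    refine ⟨k, ?_⟩
    have := neg_mem hk
    convert this using 1
    ring
  eq_of_sub_mem k l h := (hv.eq_of_sub_mem l k (by convert h using 1; ring)).symm
  map_mul_eq_one k l := by rw [neg_mul_neg]; exact hv.map_mul_eq_one k l

/-- Translation by `s` preserves the integral and also multiplies it by `χ (y * s) ≠ 1`. -/
theorem setIntegral_addChar_eq_zero (S : AddSubgroup K) {s y : K} (hs : s ∈ S)
    (hy : χ (y * s) ≠ 1) : ∫ x, (S : Set K).indicator (fun x => cchar χ (y * x)) x ∂μ = 0 := by
  set I := ∫ x, (S : Set K).indicator (fun x => cchar χ (y * x)) x ∂μ with hI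
  have h : I = cchar χ (y * s) * I := by
    conv_lhs => rw [hI, ← integral_add_right_eq_self _ s]
    rw [hI, ← integral_const_mul]
    congr 1 with x
    by_cases hx : x ∈ S
    · have hx' : x + s ∈ S := add_mem hx hs
      rw [Set.indicator_of_mem (show x + s ∈ (S : Set K) from hx'),
        Set.indicator_of_mem (show x ∈ (S : Set K) from hx), mul_add, AddChar.map_add_eq_mul,
        mul_comm]
    · have hx' : x + s ∉ S := fun h => hx (by simpa using sub_mem h hs)
      rw [Set.indicator_of_notMem (show x + s ∉ (S : Set K) from hx'),
        Set.indicator_of_notMem (show x ∉ (S : Set K) from hx), mul_zero]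
  by_contra h0
  apply hy
  exact cchar_eq_one.1 (mul_right_cancel₀ h0 (by rw [← h, one_mul]))

/-- The fractional ideal of all `x` with `a * x ∈ 𝒪`. -/
noncomputable def fracIdeal (a : K) : AddSubgroup K :=
  𝒪[K].toAddSubgroup.comap (AddMonoidHom.mulLeft a)

theorem mem_fracIdeal {a x : K} : x ∈ fracIdeal a ↔ a * x ∈ 𝒪[K] := Iff.rfl

theorem isOpen_fracIdeal (a : K) : IsOpen (fracIdeal a : Set K) :=
  isOpen_integer.preimage (by fun_prop : Continuous fun x => a * x)

theorem isCompact_fracIdeal {a : K} (ha : a ≠ 0) : IsCompact (fracIdeal a : Set K) :=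
  (Homeomorph.mulLeft₀ a ha).isCompact_preimage.2 isCompact_integer

theorem IsCharLattice.integral_fracIdeal (hv : IsCharLattice χ v) {a : K} (ha : a ≠ 0) (y : K) :
    ∫ x, (fracIdeal a : Set K).indicator (fun x => cchar χ (y * x)) x ∂μ =
      (fracIdeal a⁻¹ : Set K).indicator (fun _ => (μ.real (fracIdeal a) : ℂ)) y := by
  by_cases hy : y ∈ fracIdeal a⁻¹
  · rw [Set.indicator_of_mem (show y ∈ (fracIdeal a⁻¹ : Set K) from hy)]
    have : (fracIdeal a : Set K).indicator (fun x => cchar χ (y * x)) =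
        (fracIdeal a : Set K).indicator fun _ => 1 := by
      refine Set.indicator_congr fun x hx => ?_
      have h : y * x = (a⁻¹ * y) * (a * x) := by field_simp
      rw [h, hv.cchar_integer (mul_mem (mem_fracIdeal.1 hy) (mem_fracIdeal.1 hx))]
    rw [this, integral_indicator_const _ (isOpen_fracIdeal a).measurableSet]
    simp
  · rw [Set.indicator_of_notMem (show y ∉ (fracIdeal a⁻¹ : Set K) from hy)]
    have : ∃ x ∈ 𝒪[K], χ (a⁻¹ * y * x) ≠ 1 := by
      by_contra! h
      exact hy (hv.mem_integer _ h)
    obtain ⟨x, hx, hxy⟩ := this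
    refine setIntegral_addChar_eq_zero _ (s := a⁻¹ * x) ?_ ?_
    · rw [mem_fracIdeal, mul_inv_cancel_left₀ ha]; exact hx
    · convert hxy using 2; ring

variable [SecondCountableTopology K]

theorem memLp_indicator_of_norm_le {S : Set K} (hS : MeasurableSet S) (hSμ : μ S ≠ ⊤) {g : K → ℂ}
    (hg : Measurable g) (hg1 : ∀ x, ‖g x‖ ≤ 1) (r : ℝ≥0∞) : MemLp (S.indicator g) r μ := by
  rw [memLp_indicator_iff_restrict hS]
  haveI : IsFiniteMeasure (μ.restrict S) := isFiniteMeasure_restrict.2 hSμ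
  exact MemLp.of_bound hg.aestronglyMeasurable 1 (Eventually.of_forall hg1)

theorem integral_fourierIntegral_mul (hχ : Continuous χ) {f g : K → ℂ} (hf : Integrable f μ)
    (hg : Integrable g μ) :
    ∫ ξ, Fourier.fourierIntegral χ μ f ξ * g ξ ∂μ =
      ∫ x, f x * Fourier.fourierIntegral χ μ g x ∂μ := by
  have hflip : (LinearMap.mul K K).flip = LinearMap.mul K K := by
    ext; simp
  have := VectorFourier.integral_fourierIntegral_smul_eq_flip (e := χ) (μ := μ) (ν := μ)
    (L := LinearMap.mul K K) hχ
    (by simpa using continuous_mul) hf hg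
  rw [hflip] at this
  simpa [Fourier.fourierIntegral] using this

theorem fourierIntegral_apply (χ : AddChar K Circle) (f : K → ℂ) (ξ : K) :
    Fourier.fourierIntegral χ μ f ξ = ∫ x, cchar χ (-(x * ξ)) * f x ∂μ := by
  simp only [Fourier.fourierIntegral_def, Circle.smul_def, smul_eq_mul, cchar_def]

/-- The indicator of a ball is, up to a nonzero constant, the Fourier transform of a character cut
off to the dual ideal. The multiplication formula moves that transform onto `f`. -/
theorem IsCharLattice.setIntegral_ballAt_eq_zero (hv : IsCharLattice χ v) {f : K → ℂ}
    (hf : Integrable f μ) (h : ∀ ξ, Fourier.fourierIntegral χ μ f ξ = 0) {a : K} (ha : a ≠ 0)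
    (b : K) : ∫ x in ballAt a b, f x ∂μ = 0 := by
  classical
  set S : Set K := (fracIdeal a⁻¹ : Set K)
  have hSo : IsOpen S := isOpen_fracIdeal _
  have hSc : IsCompact S := isCompact_fracIdeal (inv_ne_zero ha)
  set g : K → ℂ := S.indicator fun x => cchar χ ((a⁻¹ * b) * x)
  have hg : Integrable g μ := memLp_one_iff_integrable.1
    (memLp_indicator_of_norm_le hSo.measurableSet hSc.measure_lt_top.ne
      (hv.continuous_cchar.comp (by fun_prop)).measurable (fun x => (norm_cchar χ _).le) 1)
  have hc : μ.real S ≠ 0 := by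
    rw [Measure.real, ENNReal.toReal_ne_zero]
    exact ⟨(hSo.measure_pos μ ⟨0, zero_mem (fracIdeal a⁻¹)⟩).ne', hSc.measure_lt_top.ne⟩
  have hgF : ∀ x, Fourier.fourierIntegral χ μ g x =
      (ballAt a b).indicator (fun _ => (μ.real S : ℂ)) x := by
    intro x
    have h1 := hv.integral_fracIdeal (μ := μ) (inv_ne_zero ha) (a⁻¹ * b - x)
    rw [fourierIntegral_apply]
    convert h1 using 1
    · congr 1 with y
      simp only [g, Set.indicator_apply]
      split_ifs with hy
      · rw [← AddChar.map_add_eq_mul]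
        congr 2; ring
      · rw [mul_zero]
    · have : x ∈ ballAt a b ↔ a⁻¹ * b - x ∈ (fracIdeal a⁻¹⁻¹ : Set K) := by
        rw [mem_ballAt, SetLike.mem_coe, mem_fracIdeal, inv_inv, mul_sub,
          mul_inv_cancel_left₀ ha, ← neg_mem_iff, neg_sub]
      simp only [Set.indicator_apply, this, S]
  have := integral_fourierIntegral_mul hv.continuous hf hg
  simp only [h, zero_mul, integral_zero, hgF] at this
  have h2 : ∀ x, f x * (ballAt a b).indicator (fun _ => (μ.real S : ℂ)) x =
      (ballAt a b).indicator f x * (μ.real S : ℂ) := by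
    intro x
    simp only [Set.indicator_apply]
    split_ifs <;> simp
  simp only [h2] at this
  rw [integral_mul_const, integral_indicator (measurableSet_ballAt a b), eq_comm, mul_eq_zero] at this
  exact this.resolve_right (by exact_mod_cast hc)

/-- The balls form a π-system generating the Borel sets, so vanishing integrals over balls extend to
all measurable sets; complements use the value of the transform at `0`. -/
theorem IsCharLattice.ae_eq_zero_of_fourierIntegral_eq_zero (hv : IsCharLattice χ v) {ϖ : 𝒪[K]}
    (hϖ : Irreducible ϖ) {f : K → ℂ} (hf : Integrable f μ)
    (h : ∀ ξ, Fourier.fourierIntegral χ μ f ξ = 0) : f =ᵐ[μ] 0 := by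
  refine hf.ae_eq_zero_of_forall_setIntegral_eq_zero fun s hs hs' => ?_
  clear hs'
  have huniv : ∫ x, f x ∂μ = 0 := by
    simpa [fourierIntegral_apply] using h 0
  have hB := isTopologicalBasis_ballAt hϖ hv.exists_sub_mem
  have hgen : ‹MeasurableSpace K› = MeasurableSpace.generateFrom _ :=
    (BorelSpace.measurable_eq (α := K)).trans hB.borel_eq_generateFrom
  induction s, hs using MeasurableSpace.induction_on_inter hgen (isPiSystem_ballAt hϖ v) with
  | empty => simp
  | basic t ht =>
    obtain ⟨i, rfl⟩ := ht
    exact hv.setIntegral_ballAt_eq_zero hf h (pow_ne_zero _ (inv_ne_zero (ϖ_ne_zero hϖ))) _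
  | compl t ht ih =>
    have := integral_add_compl ht hf
    rw [ih, zero_add, huniv] at this
    exact this
  | iUnion t hd ht ih =>
    rw [integral_iUnion ht hd hf.integrableOn]
    simp [ih]

end Gabor

/-! ### Gabor bases and the Fourier transform on `L²`. -/

section GaborBasis

variable {K : Type*} [Field K] [ValuativeRel K] [TopologicalSpace K] [IsNonarchimedeanLocalField K]
  [MeasurableSpace K] [BorelSpace K] {μ : Measure K} [μ.IsAddHaarMeasure]
  {χ : AddChar K Circle} {v w : ℕ → K} [SecondCountableTopology K]

/-- The Gabor atom: the character `x ↦ χ (y * x)` cut off to the coset `t + 𝒪`. -/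
noncomputable def atom (χ : AddChar K Circle) (t y : K) : K → ℂ :=
  (ballAt 1 t).indicator fun x => cchar χ (y * x)

theorem mem_ballAt_one {t x : K} : x ∈ ballAt 1 t ↔ x - t ∈ 𝒪[K] := by
  rw [mem_ballAt, one_mul]

theorem measure_ballAt_one (hμ : μ (𝒪[K] : Set K) = 1) (t : K) : μ (ballAt 1 t) = 1 := by
  have : ballAt 1 t = (fun x => x + -t) ⁻¹' (𝒪[K] : Set K) := by
    ext x; rw [mem_ballAt_one, sub_eq_add_neg]; rfl
  rw [this, measure_preimage_add_right, hμ]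

theorem conj_atom (χ : AddChar K Circle) (t y x : K) :
    (starRingEnd ℂ) (atom χ t y x) = atom χ t (-y) x := by
  classical
  simp only [atom, Set.indicator_apply]
  split_ifs
  · rw [conj_cchar, neg_mul]
  · simp

theorem IsCharLattice.memLp_atom (hv : IsCharLattice χ v) (hμ : μ (𝒪[K] : Set K) = 1) (t y : K)
    (r : ℝ≥0∞) : MemLp (atom χ t y) r μ :=
  memLp_indicator_of_norm_le (measurableSet_ballAt 1 t) (by simp [measure_ballAt_one hμ])
    (hv.continuous_cchar.comp (by fun_prop : Continuous fun x => y * x)).measurable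
    (fun x => (norm_cchar χ _).le) r

theorem IsCharLattice.integrable_atom (hv : IsCharLattice χ v) (hμ : μ (𝒪[K] : Set K) = 1)
    (t y : K) : Integrable (atom χ t y) μ :=
  memLp_one_iff_integrable.1 (hv.memLp_atom hμ t y 1)

/-- The transform rotates the time-frequency plane, `(t, y) ↦ (y, -t)`. At lattice points the phase
is `1`, so it carries one Gabor system exactly to another. -/
theorem IsCharLattice.fourierIntegral_atom (hv : IsCharLattice χ v) (hμ : μ (𝒪[K] : Set K) = 1)
    (t y ξ : K) :
    Fourier.fourierIntegral χ μ (atom χ t y) ξ = cchar χ (t * y) * atom χ y (-t) ξ := by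
  classical
  rw [fourierIntegral_apply, ← integral_add_right_eq_self _ t]
  have h1 : ∀ x, cchar χ (-((x + t) * ξ)) * atom χ t y (x + t) =
      cchar χ ((y - ξ) * t) *
        (fracIdeal (1 : K) : Set K).indicator (fun x => cchar χ ((y - ξ) * x)) x := by
    intro x
    have : x + t ∈ ballAt 1 t ↔ x ∈ (fracIdeal (1 : K) : Set K) := by
      rw [mem_ballAt_one, add_sub_cancel_right, SetLike.mem_coe, mem_fracIdeal, one_mul]
    simp only [atom, Set.indicator_apply, this]
    split_ifs
    · rw [← AddChar.map_add_eq_mul, ← AddChar.map_add_eq_mul]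
      congr 1; ring
    · simp
  simp only [h1]
  rw [integral_const_mul, hv.integral_fracIdeal one_ne_zero]
  have h2 : y - ξ ∈ (fracIdeal (1 : K)⁻¹ : Set K) ↔ ξ ∈ ballAt 1 y := by
    rw [SetLike.mem_coe, mem_fracIdeal, inv_one, one_mul, mem_ballAt_one, ← neg_mem_iff, neg_sub]
  have h3 : (fracIdeal (1 : K) : Set K) = 𝒪[K] := by
    ext; simp [mem_fracIdeal]
  simp only [atom, Set.indicator_apply, h2, h3, Measure.real, hμ]
  split_ifs
  · rw [← AddChar.map_add_eq_mul]
    simp only [ENNReal.toReal_one, Complex.ofReal_one, mul_one]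
    congr 1; ring
  · simp

/-- The Gabor atom as an element of `L²`. -/
noncomputable def IsCharLattice.atomLp (hv : IsCharLattice χ v) (hμ : μ (𝒪[K] : Set K) = 1)
    (t y : K) : Lp ℂ 2 μ := (hv.memLp_atom hμ t y 2).toLp

theorem IsCharLattice.inner_atomLp (hv : IsCharLattice χ v) (hμ : μ (𝒪[K] : Set K) = 1)
    (t y : K) (f : Lp ℂ 2 μ) : inner ℂ (hv.atomLp hμ t y) f = ∫ x, f x * atom χ t (-y) x ∂μ := by
  rw [L2.inner_def]
  refine integral_congr_ae ?_
  filter_upwards [(hv.memLp_atom hμ t y 2).coeFn_toLp] with x hx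
  rw [RCLike.inner_apply, atomLp, hx, conj_atom]

/-- Atoms over different cosets have disjoint supports. Over one coset the inner product is the
transform of the atom of frequency `w k'`, evaluated at `w k`; it lives on `w k' + 𝒪`. -/
theorem IsCharLattice.orthonormal_atomLp (hv : IsCharLattice χ v) (hw : IsCharLattice χ w)
    (hμ : μ (𝒪[K] : Set K) = 1) :
    Orthonormal ℂ fun i : ℕ × ℕ => hv.atomLp hμ (v i.1) (w i.2) := by
  classical
  rw [orthonormal_iff_ite]
  rintro ⟨l, k⟩ ⟨l', k'⟩
  rw [hv.inner_atomLp]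
  have h1 : ∫ x, hv.atomLp hμ (v l') (w k') x * atom χ (v l) (-w k) x ∂μ =
      ∫ x, atom χ (v l') (w k') x * atom χ (v l) (-w k) x ∂μ := by
    refine integral_congr_ae ?_
    filter_upwards [(hv.memLp_atom hμ (v l') (w k') 2).coeFn_toLp] with x hx
    rw [atomLp, hx]
  rw [h1]
  by_cases hl : l = l'
  · subst hl
    have h2 : ∀ x, atom χ (v l) (w k') x * atom χ (v l) (-w k) x =
        cchar χ (-(x * w k)) * atom χ (v l) (w k') x := by
      intro x
      simp only [atom, Set.indicator_apply]
      split_ifs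
      · rw [mul_comm, neg_mul, mul_comm (w k) x]
      · simp
    simp only [h2]
    rw [← fourierIntegral_apply, hv.fourierIntegral_atom hμ]
    by_cases hk : k = k'
    · subst hk
      rw [atom, Set.indicator_of_mem (by rw [mem_ballAt_one, sub_self]; exact zero_mem _), if_pos rfl,
        ← AddChar.map_add_eq_mul, neg_mul, add_neg_cancel, AddChar.map_zero_eq_one]
    · rw [atom, Set.indicator_of_notMem, if_neg (by simp [hk]), mul_zero]
      rw [mem_ballAt_one]
      exact fun h => hk (hw.eq_of_sub_mem _ _ h)
  · rw [if_neg (by simp [hl])]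
    have h2 : ∀ x, atom χ (v l') (w k') x * atom χ (v l) (-w k) x = 0 := by
      intro x
      simp only [atom, Set.indicator_apply]
      split_ifs with h h'
      · refine absurd (hv.eq_of_sub_mem l l' ?_) hl
        have := sub_mem (mem_ballAt_one.1 h) (mem_ballAt_one.1 h')
        simpa using this
      all_goals simp
    simp [h2]

/-- Restrict `f` to one coset of `𝒪`. On each coset `w k + 𝒪` its transform only changes by a
unimodular factor, so vanishing at all `w k` forces it to vanish everywhere, and injectivity on `L¹`
applies. -/
theorem IsCharLattice.orthogonal_atomLp (hv : IsCharLattice χ v) (hw : IsCharLattice χ w)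
    (hμ : μ (𝒪[K] : Set K) = 1) {ϖ : 𝒪[K]} (hϖ : Irreducible ϖ) :
    (Submodule.span ℂ (Set.range fun i : ℕ × ℕ => hv.atomLp hμ (v i.1) (w i.2)))ᗮ = ⊥ := by
  classical
  rw [Submodule.eq_bot_iff]
  intro f hf
  have h0 : ∀ l k, ∫ x, f x * atom χ (v l) (-w k) x ∂μ = 0 := by
    intro l k
    rw [← hv.inner_atomLp hμ]
    exact (Submodule.mem_orthogonal _ _).1 hf _ (Submodule.subset_span ⟨(l, k), rfl⟩)
  have key : ∀ l, (ballAt 1 (v l)).indicator f =ᵐ[μ] 0 := by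
    intro l
    have hint : Integrable ((ballAt 1 (v l)).indicator f) μ := by
      have := (Lp.memLp f).integrable_mul (hv.memLp_atom hμ (v l) 0 2)
      refine this.congr (Eventually.of_forall fun x => ?_)
      simp only [Pi.mul_apply, atom, Set.indicator_apply]
      split_ifs <;> simp
    refine hv.ae_eq_zero_of_fourierIntegral_eq_zero hϖ hint fun ξ => ?_
    obtain ⟨k, hk⟩ := hw.exists_sub_mem ξ
    have h1 : ∀ x, cchar χ (-(x * ξ)) * (ballAt 1 (v l)).indicator f x =
        cchar χ (-(v l * (ξ - w k))) * (f x * atom χ (v l) (-w k) x) := by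
      intro x
      simp only [atom, Set.indicator_apply]
      split_ifs with hx
      · have h2 : -(x * ξ) = -(v l * (ξ - w k)) + -w k * x + -((x - v l) * (ξ - w k)) := by ring
        rw [h2, AddChar.map_add_eq_mul, AddChar.map_add_eq_mul,
          hv.cchar_integer (neg_mem (mul_mem (mem_ballAt_one.1 hx) hk))]
        ring
      · simp
    rw [fourierIntegral_apply]
    simp only [h1]
    rw [integral_const_mul, h0, mul_zero]
  rw [Lp.eq_zero_iff_ae_eq_zero]
  filter_upwards [ae_all_iff.2 key] with x hx
  obtain ⟨l, hl⟩ := hv.exists_sub_mem x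
  have := hx l
  rwa [Set.indicator_of_mem (mem_ballAt_one.2 hl)] at this

/-- The Gabor basis of `L²`. -/
noncomputable def IsCharLattice.gaborBasis (hv : IsCharLattice χ v) (hw : IsCharLattice χ w)
    (hμ : μ (𝒪[K] : Set K) = 1) {ϖ : 𝒪[K]} (hϖ : Irreducible ϖ) :
    HilbertBasis (ℕ × ℕ) ℂ (Lp ℂ 2 μ) :=
  HilbertBasis.mkOfOrthogonalEqBot (hv.orthonormal_atomLp hw hμ) (hv.orthogonal_atomLp hw hμ hϖ)

/-- The image of the Gabor basis under the Fourier transform. -/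
noncomputable def IsCharLattice.dualGaborBasis (hv : IsCharLattice χ v)
    (hμ : μ (𝒪[K] : Set K) = 1) {ϖ : 𝒪[K]} (hϖ : Irreducible ϖ) :
    HilbertBasis (ℕ × ℕ) ℂ (Lp ℂ 2 μ) :=
  HilbertBasis.mkOfOrthogonalEqBot
    ((hv.orthonormal_atomLp hv.neg hμ).comp Prod.swap Prod.swap_injective) (by
      have := hv.orthogonal_atomLp hv.neg hμ hϖ
      rwa [← Prod.swap_surjective.range_comp] at this)

/-- The Fourier transform on `L²`, as a unitary operator. -/
noncomputable def IsCharLattice.fourierL2 (hv : IsCharLattice χ v)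
    (hμ : μ (𝒪[K] : Set K) = 1) {ϖ : 𝒪[K]} (hϖ : Irreducible ϖ) : Lp ℂ 2 μ ≃ₗᵢ[ℂ] Lp ℂ 2 μ :=
  (hv.gaborBasis hv hμ hϖ).repr.trans (hv.dualGaborBasis hμ hϖ).repr.symm

/-- Both sides are continuous in the pair, so the graph on `L¹ ∩ L²` suffices; there the
multiplication formula moves the transform to the atom. Hence the closure of the graph agrees with
the unitary `fourierL2`. -/
theorem IsCharLattice.inner_of_isL2Fourier (hv : IsCharLattice χ v) (hμ : μ (𝒪[K] : Set K) = 1)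
    {f g : Lp ℂ 2 μ} (h : IsL2Fourier χ μ f g) (l k : ℕ) :
    inner ℂ (hv.atomLp hμ (v l) (v k)) f = inner ℂ (hv.atomLp hμ (v k) (-v l)) g := by
  have hcl : IsClosed {z : Lp ℂ 2 μ × Lp ℂ 2 μ |
      inner ℂ (hv.atomLp hμ (v l) (v k)) z.1 = inner ℂ (hv.atomLp hμ (v k) (-v l)) z.2} :=
    isClosed_eq (by fun_prop) (by fun_prop)
  refine hcl.closure_subset_iff.2 ?_ h
  rintro ⟨f, g⟩ ⟨hf, hg⟩
  simp only [Set.mem_ofPred_eq]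
  dsimp only at hf hg
  rw [hv.inner_atomLp, hv.inner_atomLp, neg_neg]
  have h1 : ∫ x, g x * atom χ (v k) (v l) x ∂μ =
      ∫ x, Fourier.fourierIntegral χ μ f x * atom χ (v k) (v l) x ∂μ := by
    refine integral_congr_ae ?_
    filter_upwards [hg] with x hx
    rw [hx]
  rw [h1, integral_fourierIntegral_mul hv.continuous hf (hv.integrable_atom hμ _ _)]
  simp only [hv.fourierIntegral_atom hμ, hv.cchar_mul, one_mul]

theorem IsCharLattice.fourierL2_eq (hv : IsCharLattice χ v) (hμ : μ (𝒪[K] : Set K) = 1)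
    {ϖ : 𝒪[K]} (hϖ : Irreducible ϖ) {f g : Lp ℂ 2 μ} (h : IsL2Fourier χ μ f g) :
    hv.fourierL2 hμ hϖ f = g := by
  have : (hv.gaborBasis hv hμ hϖ).repr f = (hv.dualGaborBasis hμ hϖ).repr g := by
    ext ⟨l, k⟩
    rw [HilbertBasis.repr_apply_apply, HilbertBasis.repr_apply_apply, gaborBasis, dualGaborBasis,
      HilbertBasis.coe_mkOfOrthogonalEqBot, HilbertBasis.coe_mkOfOrthogonalEqBot]
    exact hv.inner_of_isL2Fourier hμ h l k
  rw [fourierL2, LinearIsometryEquiv.trans_apply, this, LinearIsometryEquiv.symm_apply_apply]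

end GaborBasis

/-! ### Square sums and `L²` norms in `ℝ≥0∞`. -/

theorem hasSum_iff_tsum_ofReal {ι : Type*} {f : ι → ℝ} (hf : ∀ i, 0 ≤ f i) {r : ℝ} (hr : 0 ≤ r) :
    HasSum f r ↔ ∑' i, ENNReal.ofReal (f i) = ENNReal.ofReal r := by
  constructor
  · intro h
    rw [← ENNReal.ofReal_tsum_of_nonneg hf h.summable, h.tsum_eq]
  · intro h
    have hs : Summable f := by
      have := ENNReal.summable_toReal (f := fun i => ENNReal.ofReal (f i)) (by simp [h])
      simpa [ENNReal.toReal_ofReal, hf] using this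
    rw [← ENNReal.ofReal_tsum_of_nonneg hf hs,
      ENNReal.ofReal_eq_ofReal_iff (tsum_nonneg hf) hr] at h
    rw [← h]
    exact hs.hasSum

theorem ofReal_norm_sq {E : Type*} [SeminormedAddCommGroup E] (x : E) :
    ENNReal.ofReal (‖x‖ ^ 2) = ‖x‖ₑ ^ 2 := by
  rw [ENNReal.ofReal_pow (norm_nonneg x), ofReal_norm]

theorem hasSum_norm_sq_iff {ι E F : Type*} [SeminormedAddCommGroup E] [SeminormedAddCommGroup F]
    (f : ι → E) (x : F) :
    HasSum (fun i => ‖f i‖ ^ 2) (‖x‖ ^ 2) ↔ ∑' i, ‖f i‖ₑ ^ 2 = ‖x‖ₑ ^ 2 := by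
  rw [hasSum_iff_tsum_ofReal (fun i => by positivity) (by positivity)]
  simp only [ofReal_norm_sq]

theorem tsum_enorm_inner_sq {ι E : Type*} [NormedAddCommGroup E] [InnerProductSpace ℂ E]
    [CompleteSpace E] (b : HilbertBasis ι ℂ E) (x : E) :
    ∑' i, ‖inner ℂ (b i) x‖ₑ ^ 2 = ‖x‖ₑ ^ 2 := by
  rw [← hasSum_norm_sq_iff]
  have h := Complex.hasSum_re (b.hasSum_inner_mul_inner x x)
  rw [inner_self_eq_norm_sq_to_K] at h
  convert h using 1
  · ext i
    rw [← inner_conj_symm x (b i), ← Complex.normSq_eq_conj_mul_self, Complex.ofReal_re,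
      Complex.normSq_eq_norm_sq]
  · norm_cast

theorem enorm_sq_eq_lintegral {X : Type*} [MeasurableSpace X] {μ : Measure X} (f : Lp ℂ 2 μ) :
    ‖f‖ₑ ^ 2 = ∫⁻ x, ‖f x‖ₑ ^ 2 ∂μ := by
  rw [Lp.enorm_def, eLpNorm_eq_lintegral_rpow_enorm_toReal (by simp) (by simp),
    ← ENNReal.rpow_natCast, ← ENNReal.rpow_mul]
  simp

theorem memLp_two_of_lintegral {X : Type*} [MeasurableSpace X] {μ : Measure X} {f : X → ℂ}
    (hf : AEStronglyMeasurable f μ) (h : ∫⁻ x, ‖f x‖ₑ ^ 2 ∂μ ≠ ⊤) : MemLp f 2 μ := by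
  refine ⟨hf, ?_⟩
  rw [eLpNorm_eq_lintegral_rpow_enorm_toReal (by simp) (by simp)]
  exact ENNReal.rpow_lt_top_of_nonneg (by simp) (by simpa using h)

theorem enorm_sq_tsum_of_disjoint {ι : Type*} (f : ι → ℂ)
    (h : ∀ i j, i ≠ j → f i = 0 ∨ f j = 0) :
    Summable f ∧ ‖∑' i, f i‖ₑ ^ 2 = ∑' i, ‖f i‖ₑ ^ 2 := by
  by_cases h0 : ∀ i, f i = 0
  · have : f = 0 := funext h0
    subst this
    exact ⟨summable_zero, by simp⟩
  · push Not at h0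
    obtain ⟨i, hi⟩ := h0
    have h1 : ∀ j, j ≠ i → f j = 0 := fun j hj => (h j i hj).resolve_right hi
    refine ⟨(hasSum_single i h1).summable, ?_⟩
    rw [tsum_eq_single i h1, tsum_eq_single i (fun j hj => by simp [h1 j hj])]

/-! ### Periodization over the lattice. -/

section Fold

variable {K : Type*} [Field K] [ValuativeRel K] [TopologicalSpace K] [IsNonarchimedeanLocalField K]
  [MeasurableSpace K] [BorelSpace K] {μ : Measure K} [μ.IsAddHaarMeasure]
  {χ : AddChar K Circle} {v : ℕ → K} [SecondCountableTopology K]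

theorem IsCharLattice.iUnion_ballAt (hv : IsCharLattice χ v) (a : K) :
    ⋃ l, ballAt a (v l) = Set.univ := by
  refine Set.eq_univ_of_forall fun x => ?_
  obtain ⟨l, hl⟩ := hv.exists_sub_mem (a * x)
  exact Set.mem_iUnion.2 ⟨l, hl⟩

theorem IsCharLattice.pairwise_disjoint_ballAt (hv : IsCharLattice χ v) :
    Pairwise (Function.onFun Disjoint fun l => ballAt 1 (v l)) := by
  intro k l hkl
  refine Set.disjoint_left.2 fun x hx hx' => hkl (hv.eq_of_sub_mem k l ?_)
  simpa using sub_mem (mem_ballAt_one.1 hx') (mem_ballAt_one.1 hx)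

theorem indicator_ballAt_add {E : Type*} [Zero E] (g : K → E) (t x : K) :
    (ballAt 1 t).indicator g (x + t) = (𝒪[K] : Set K).indicator (fun x => g (x + t)) x := by
  classical
  have : x + t ∈ ballAt 1 t ↔ x ∈ (𝒪[K] : Set K) := by
    rw [mem_ballAt_one, add_sub_cancel_right]; rfl
  simp only [Set.indicator_apply, this]

theorem IsCharLattice.tsum_lintegral_integer (hv : IsCharLattice χ v) (g : K → ℝ≥0∞) :
    ∑' l, ∫⁻ x in 𝒪[K], g (x + v l) ∂μ = ∫⁻ x, g x ∂μ := by
  rw [← setLIntegral_univ, ← hv.iUnion_ballAt 1,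
    lintegral_iUnion (fun l => measurableSet_ballAt _ _) hv.pairwise_disjoint_ballAt]
  congr 1 with l
  rw [← lintegral_indicator measurableSet_integer, ← lintegral_indicator (measurableSet_ballAt _ _),
    ← lintegral_add_right_eq_self ((ballAt 1 (v l)).indicator g) (v l)]
  simp only [indicator_ballAt_add]

theorem IsCharLattice.tsum_integral_integer (hv : IsCharLattice χ v) {g : K → ℂ}
    (hg : Integrable g μ) : ∑' l, ∫ x in 𝒪[K], g (x + v l) ∂μ = ∫ x, g x ∂μ := by
  rw [← setIntegral_univ, ← hv.iUnion_ballAt 1,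
    integral_iUnion (fun l => measurableSet_ballAt _ _) hv.pairwise_disjoint_ballAt hg.integrableOn]
  congr 1 with l
  rw [← integral_indicator measurableSet_integer, ← integral_indicator (measurableSet_ballAt _ _),
    ← integral_add_right_eq_self ((ballAt 1 (v l)).indicator g) (v l)]
  simp only [indicator_ballAt_add]

/-- Parseval's identity on a set whose translates by the lattice are disjoint. -/
theorem IsCharLattice.tsum_enorm_integral_mul_sq (hv : IsCharLattice χ v)
    (hμ : μ (𝒪[K] : Set K) = 1) {ϖ : 𝒪[K]} (hϖ : Irreducible ϖ) {h : K → ℂ}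
    (hint : Integrable h μ) (hL2 : MemLp h 2 μ)
    (hd : ∀ l l', l ≠ l' → ∀ᵐ x ∂μ, h (x + v l) = 0 ∨ h (x + v l') = 0) :
    ∑' k, ‖∫ x, h x * cchar χ (v k * x) ∂μ‖ₑ ^ 2 = ∫⁻ x, ‖h x‖ₑ ^ 2 ∂μ := by
  classical
  have hae : ∀ᵐ x ∂μ, ∀ l l', l ≠ l' → h (x + v l) = 0 ∨ h (x + v l') = 0 := by
    simp only [ae_all_iff]
    exact hd
  -- The periodization of `h`; almost everywhere at most one term is nonzero.
  set G₀ : K → ℂ := fun x => ∑' l, h (x + v l)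
  have hmeas : ∀ l, AEStronglyMeasurable (fun x => h (x + v l)) μ := fun l =>
    (hint.comp_add_right (v l)).aestronglyMeasurable
  have hG₀ : AEStronglyMeasurable G₀ μ := by
    refine aestronglyMeasurable_of_tendsto_ae atTop
      (f := fun (n : ℕ) x => ∑ l ∈ Finset.range n, h (x + v l))
      (fun n => Finset.aestronglyMeasurable_fun_sum _ fun l _ => hmeas l) ?_
    filter_upwards [hae] with x hx
    exact (enorm_sq_tsum_of_disjoint _ hx).1.hasSum.tendsto_sum_nat
  set G : K → ℂ := (𝒪[K] : Set K).indicator G₀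
  have hG : AEStronglyMeasurable G μ := hG₀.indicator measurableSet_integer
  have hGnorm : ∫⁻ x, ‖G x‖ₑ ^ 2 ∂μ = ∫⁻ x, ‖h x‖ₑ ^ 2 ∂μ := by
    rw [← hv.tsum_lintegral_integer fun x => ‖h x‖ₑ ^ 2, ← lintegral_tsum fun l =>
      ((hmeas l).enorm.pow_const 2).restrict, ← lintegral_indicator measurableSet_integer]
    refine lintegral_congr_ae ?_
    filter_upwards [hae] with x hx
    simp only [G, Set.indicator_apply]
    split_ifs
    · exact (enorm_sq_tsum_of_disjoint _ hx).2
    · simp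
  have hfin : ∫⁻ x, ‖h x‖ₑ ^ 2 ∂μ ≠ ⊤ := by
    have : ∫⁻ x, ‖h x‖ₑ ^ 2 ∂μ = ‖hL2.toLp‖ₑ ^ 2 := by
      rw [enorm_sq_eq_lintegral]
      refine lintegral_congr_ae ?_
      filter_upwards [hL2.coeFn_toLp] with x hx
      rw [hx]
    rw [this]
    exact ENNReal.pow_ne_top enorm_ne_top
  have hGL2 : MemLp G 2 μ := memLp_two_of_lintegral hG (by rw [hGnorm]; exact hfin)
  -- `G` lives on `𝒪`, the coset with `l = 0` since `v 0 = 0`. The frequencies `-v k` cancel the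
  -- conjugation in the inner product.
  have hcoef : ∀ l k, inner ℂ (hv.gaborBasis hv.neg hμ hϖ (l, k)) (hGL2.toLp : Lp ℂ 2 μ) =
      if l = 0 then ∫ x, h x * cchar χ (v k * x) ∂μ else 0 := by
    intro l k
    rw [gaborBasis, HilbertBasis.coe_mkOfOrthogonalEqBot, inner_atomLp, neg_neg]
    have h1 : ∫ x, (hGL2.toLp : Lp ℂ 2 μ) x * atom χ (v l) (v k) x ∂μ =
        ∫ x, G x * atom χ (v l) (v k) x ∂μ := by
      refine integral_congr_ae ?_
      filter_upwards [hGL2.coeFn_toLp] with x hx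
      rw [hx]
    rw [h1]
    split_ifs with hl
    · subst hl
      have h2 : Integrable (fun x => h x * cchar χ (v k * x)) μ := by
        refine hint.mul_bdd (c := 1) ?_ (Eventually.of_forall fun x => (norm_cchar χ _).le)
        exact (hv.continuous_cchar.comp
          (by fun_prop : Continuous fun x => v k * x)).aestronglyMeasurable
      have h3 : ∀ x, G x * atom χ (v 0) (v k) x = (𝒪[K] : Set K).indicator
          (fun x => ∑' l, h (x + v l) * cchar χ (v k * (x + v l))) x := by
        intro x
        have hx0 : x ∈ ballAt 1 (v 0) ↔ x ∈ (𝒪[K] : Set K) := by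
          rw [mem_ballAt_one, hv.zero, sub_zero]; rfl
        simp only [G, G₀, atom, Set.indicator_apply, hx0]
        split_ifs
        · rw [← tsum_mul_right]
          congr 1 with l
          -- The character is invariant under the lattice, so the integral over `𝒪` unfolds to one
          -- over `K`.
          rw [mul_add, AddChar.map_add_eq_mul, hv.cchar_mul, mul_one]
        · simp
      simp only [h3]
      rw [integral_indicator measurableSet_integer, integral_tsum, hv.tsum_integral_integer h2]
      · intro l
        exact (h2.comp_add_right (v l)).aestronglyMeasurable.restrict
      · rw [hv.tsum_lintegral_integer fun x => ‖h x * cchar χ (v k * x)‖ₑ]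
        exact h2.hasFiniteIntegral.ne
    · have h3 : ∀ x, G x * atom χ (v l) (v k) x = 0 := by
        intro x
        simp only [G, atom, Set.indicator_apply]
        split_ifs with hx hx'
        · refine absurd (hv.eq_of_sub_mem l 0 ?_) hl
          rw [hv.zero, sub_zero]
          simpa using sub_mem (show x ∈ 𝒪[K] from hx) (mem_ballAt_one.1 hx')
        all_goals simp
      simp [h3]
  have hP := tsum_enorm_inner_sq (hv.gaborBasis hv.neg hμ hϖ) hGL2.toLp
  rw [ENNReal.tsum_prod', tsum_eq_single 0 (fun l hl => by simp [hcoef, hl])] at hP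
  simp only [hcoef, if_true] at hP
  rw [hP, enorm_sq_eq_lintegral, ← hGnorm]
  refine lintegral_congr_ae ?_
  filter_upwards [hGL2.coeFn_toLp] with x hx
  rw [hx]

end Fold

/-! ### Translations and dilations on `L²`, and their Fourier conjugates. -/

section Affine

variable {K : Type*} [Field K] [ValuativeRel K] [TopologicalSpace K] [IsNonarchimedeanLocalField K]
  [MeasurableSpace K] [BorelSpace K] {μ : Measure K} [μ.IsAddHaarMeasure]
  {χ : AddChar K Circle} {v : ℕ → K} [SecondCountableTopology K]

theorem HasScale.quasiMeasurePreserving_sub {a : K} {r : ℝ≥0∞} (ha : HasScale μ a r) (b : K) :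
    Measure.QuasiMeasurePreserving (fun x => a * x - b) μ μ :=
  (measurePreserving_sub_right μ b).quasiMeasurePreserving.comp ha.quasiMeasurePreserving

theorem HasScale.lintegral_comp_sub {a : K} {r : ℝ≥0∞} (ha : HasScale μ a r) (ha0 : a ≠ 0) (b : K)
    (g : K → ℝ≥0∞) : ∫⁻ x, g (a * x - b) ∂μ = r * ∫⁻ x, g x ∂μ := by
  rw [ha.lintegral_comp ha0 fun x => g (x - b), lintegral_sub_right_eq_self]

theorem HasScale.lintegral_weighted {a : K} {r : ℝ≥0∞} (ha : HasScale μ a r) (ha0 : a ≠ 0) (b : K)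
    {w : K → ℂ} (hw : ∀ x, ‖w x‖ₑ ^ 2 * r = 1) (f : K → ℂ) :
    ∫⁻ x, ‖w x * f (a * x - b)‖ₑ ^ 2 ∂μ = ∫⁻ x, ‖f x‖ₑ ^ 2 ∂μ := by
  have h0 : ∀ x, ‖w x‖ₑ ^ 2 = r⁻¹ := fun x => ENNReal.eq_inv_of_mul_eq_one_left (hw x)
  have hr0 : r ≠ 0 := by rintro rfl; simpa using hw 0
  have hr : r ≠ ⊤ := by
    rintro rfl
    have := hw 0
    rw [h0] at this
    simp at this
  simp only [enorm_mul, mul_pow, h0]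
  rw [lintegral_const_mul' _ _ (ENNReal.inv_ne_top.2 hr0),
    ha.lintegral_comp_sub ha0 b fun x => ‖f x‖ₑ ^ 2, ← mul_assoc, ENNReal.inv_mul_cancel hr0 hr,
    one_mul]

theorem HasScale.memLp_weighted {a : K} {r : ℝ≥0∞} (ha : HasScale μ a r) (ha0 : a ≠ 0) (b : K)
    {w : K → ℂ} (hwm : Measurable w) (hw : ∀ x, ‖w x‖ₑ ^ 2 * r = 1) (f : Lp ℂ 2 μ) :
    MemLp (fun x => w x * f (a * x - b)) 2 μ := by
  refine memLp_two_of_lintegral (hwm.aestronglyMeasurable.mul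
    ((Lp.aestronglyMeasurable f).comp_quasiMeasurePreserving (ha.quasiMeasurePreserving_sub b))) ?_
  rw [ha.lintegral_weighted ha0 b hw, ← enorm_sq_eq_lintegral]
  exact ENNReal.pow_ne_top enorm_ne_top

/-- The weighted composition operator `f ↦ (x ↦ w x * f (a * x - b))` as an isometry of `L²`. -/
noncomputable def HasScale.weighted {a : K} {r : ℝ≥0∞} (ha : HasScale μ a r) (ha0 : a ≠ 0) (b : K)
    {w : K → ℂ} (hwm : Measurable w) (hw : ∀ x, ‖w x‖ₑ ^ 2 * r = 1) : Lp ℂ 2 μ →ₗᵢ[ℂ] Lp ℂ 2 μ where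
  toFun f := (ha.memLp_weighted ha0 b hwm hw f).toLp
  map_add' f g := by
    ext1
    filter_upwards [(ha.memLp_weighted ha0 b hwm hw (f + g)).coeFn_toLp,
      (ha.memLp_weighted ha0 b hwm hw f).coeFn_toLp, (ha.memLp_weighted ha0 b hwm hw g).coeFn_toLp,
      Lp.coeFn_add (ha.memLp_weighted ha0 b hwm hw f).toLp (ha.memLp_weighted ha0 b hwm hw g).toLp,
      (ha.quasiMeasurePreserving_sub b).ae (Lp.coeFn_add f g)] with x h1 h2 h3 h4 h5
    rw [h1, h4, Pi.add_apply, h2, h3, h5, Pi.add_apply, mul_add]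
  map_smul' c f := by
    ext1
    filter_upwards [(ha.memLp_weighted ha0 b hwm hw (c • f)).coeFn_toLp,
      (ha.memLp_weighted ha0 b hwm hw f).coeFn_toLp,
      Lp.coeFn_smul c (ha.memLp_weighted ha0 b hwm hw f).toLp,
      (ha.quasiMeasurePreserving_sub b).ae (Lp.coeFn_smul c f)] with x h1 h2 h3 h4
    rw [h1, RingHom.id_apply, h3, Pi.smul_apply, h2, h4, Pi.smul_apply, smul_eq_mul, smul_eq_mul,
      mul_left_comm]
  norm_map' f := by
    have : ‖(ha.memLp_weighted ha0 b hwm hw f).toLp‖ₑ ^ 2 = ‖f‖ₑ ^ 2 := by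
      rw [enorm_sq_eq_lintegral, enorm_sq_eq_lintegral, ← ha.lintegral_weighted ha0 b hw f]
      refine lintegral_congr_ae ?_
      filter_upwards [(ha.memLp_weighted ha0 b hwm hw f).coeFn_toLp] with x hx
      rw [hx]
    rw [← ofReal_norm_sq, ← ofReal_norm_sq,
      ENNReal.ofReal_eq_ofReal_iff (by positivity) (by positivity)] at this
    exact (sq_eq_sq₀ (norm_nonneg _) (norm_nonneg _)).1 this

theorem HasScale.weighted_ae {a : K} {r : ℝ≥0∞} (ha : HasScale μ a r) (ha0 : a ≠ 0) (b : K)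
    {w : K → ℂ} (hwm : Measurable w) (hw : ∀ x, ‖w x‖ₑ ^ 2 * r = 1) (f : Lp ℂ 2 μ) :
    ha.weighted ha0 b hwm hw f =ᵐ[μ] fun x => w x * f (a * x - b) :=
  (ha.memLp_weighted ha0 b hwm hw f).coeFn_toLp

theorem HasScale.integrable_comp_sub {a : K} {r : ℝ≥0∞} (ha : HasScale μ a r) (hr : r ≠ ⊤)
    (ha0 : a ≠ 0) (b : K) {f : K → ℂ} (hf : Integrable f μ) :
    Integrable (fun x => f (a * x - b)) μ := by
  refine ⟨hf.aestronglyMeasurable.comp_quasiMeasurePreserving (ha.quasiMeasurePreserving_sub b), ?_⟩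
  rw [HasFiniteIntegral, ha.lintegral_comp_sub ha0 b fun x => ‖f x‖ₑ]
  exact ENNReal.mul_lt_top hr.lt_top hf.hasFiniteIntegral

/-- The factor `q ^ (j / 2)`. -/
noncomputable def normFactor (K : Type*) [Field K] [ValuativeRel K] [TopologicalSpace K]
    [IsNonarchimedeanLocalField K] (j : ℤ) : ℝ := (resCard K : ℝ) ^ ((j : ℝ) / 2)

theorem resCard_pos : (0 : ℝ) < resCard K := by
  exact_mod_cast (zero_lt_one.trans one_lt_resCard)

theorem resCard_ne_zero : (resCard K : ℝ≥0∞) ≠ 0 := by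
  exact_mod_cast (zero_lt_one.trans (one_lt_resCard (K := K))).ne'

theorem resCard_zpow_ne_top (j : ℤ) : (resCard K : ℝ≥0∞) ^ j ≠ ⊤ :=
  ENNReal.zpow_ne_top resCard_ne_zero (ENNReal.natCast_ne_top _) j

theorem toReal_resCard_zpow (j : ℤ) :
    ((resCard K : ℝ≥0∞) ^ j).toReal = (resCard K : ℝ) ^ j := by
  cases j with
  | ofNat n => simp
  | negSucc n => simp [zpow_negSucc]

theorem normFactor_neg_mul (j : ℤ) :
    normFactor K (-j) = ((resCard K : ℝ≥0∞) ^ (-j)).toReal * normFactor K j := by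
  have h := resCard_pos (K := K)
  rw [normFactor, normFactor, toReal_resCard_zpow, ← Real.rpow_intCast,
    ← Real.rpow_add h]
  congr 1
  push_cast
  ring

theorem enorm_normFactor_sq (j : ℤ) : ‖(normFactor K j : ℂ)‖ₑ ^ 2 = (resCard K : ℝ≥0∞) ^ j := by
  have h := resCard_pos (K := K)
  have h1 : (‖(normFactor K j : ℂ)‖) ^ 2 = (resCard K : ℝ) ^ j := by
    rw [Complex.norm_real, normFactor, Real.norm_of_nonneg (by positivity), ← Real.rpow_natCast,
      ← Real.rpow_mul h.le, ← Real.rpow_intCast]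
    congr 1
    push_cast
    ring
  rw [← ofReal_norm_sq, h1, ← toReal_resCard_zpow, ENNReal.ofReal_toReal (resCard_zpow_ne_top j)]

theorem resCard_zpow_mul_neg (j : ℤ) : (resCard K : ℝ≥0∞) ^ j * (resCard K : ℝ≥0∞) ^ (-j) = 1 := by
  rw [← ENNReal.zpow_add resCard_ne_zero (ENNReal.natCast_ne_top _), add_neg_cancel, zpow_zero]

theorem HasScale.uniformizer_zpow {ϖ : K} (h : HasScale μ ϖ (resCard K)) (h0 : ϖ ≠ 0) (j : ℤ) :
    HasScale μ (ϖ ^ j) ((resCard K : ℝ≥0∞) ^ j) :=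
  h.zpow h0 resCard_ne_zero (ENNReal.natCast_ne_top _) j

/-- Translation by `b` followed by the dilation `D^j`, on `L²`. -/
noncomputable def affineLp {ϖ : K} (h : HasScale μ ϖ (resCard K)) (h0 : ϖ ≠ 0) (j : ℤ) (b : K) :
    Lp ℂ 2 μ →ₗᵢ[ℂ] Lp ℂ 2 μ :=
  (h.uniformizer_zpow h0 (-j)).weighted (zpow_ne_zero _ h0) b
    (w := fun _ => (normFactor K j : ℂ)) measurable_const
    (fun _ => by rw [enorm_normFactor_sq, resCard_zpow_mul_neg])

theorem affineLp_ae {ϖ : K} (h : HasScale μ ϖ (resCard K)) (h0 : ϖ ≠ 0) (j : ℤ) (b : K)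
    (f : Lp ℂ 2 μ) :
    affineLp h h0 j b f =ᵐ[μ] fun x => (normFactor K j : ℂ) * f (ϖ ^ (-j) * x - b) :=
  HasScale.weighted_ae _ _ _ _ _ _

/-- The operator conjugate to `affineLp` under the Fourier transform. -/
noncomputable def IsCharLattice.modulatedLp (hv : IsCharLattice χ v) {ϖ : K}
    (h : HasScale μ ϖ (resCard K)) (h0 : ϖ ≠ 0) (j : ℤ) (b : K) :
    Lp ℂ 2 μ →ₗᵢ[ℂ] Lp ℂ 2 μ :=
  (h.uniformizer_zpow h0 j).weighted (zpow_ne_zero _ h0) 0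
    (w := fun ξ => (normFactor K (-j) : ℂ) * cchar χ (-(b * (ϖ ^ j * ξ))))
    ((hv.continuous_cchar.comp
      (by fun_prop : Continuous fun ξ => -(b * (ϖ ^ j * ξ)))).measurable.const_mul _)
    (fun ξ => by
      rw [enorm_mul, ← ofReal_norm (cchar χ _), norm_cchar, ENNReal.ofReal_one, mul_one,
        enorm_normFactor_sq, mul_comm, resCard_zpow_mul_neg])

theorem IsCharLattice.modulatedLp_ae (hv : IsCharLattice χ v) {ϖ : K}
    (h : HasScale μ ϖ (resCard K)) (h0 : ϖ ≠ 0) (j : ℤ) (b : K) (f : Lp ℂ 2 μ) :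
    hv.modulatedLp h h0 j b f =ᵐ[μ] fun ξ =>
      (normFactor K (-j) : ℂ) * cchar χ (-(b * (ϖ ^ j * ξ))) * f (ϖ ^ j * ξ) := by
  have : hv.modulatedLp h h0 j b f =ᵐ[μ] fun ξ =>
      (normFactor K (-j) : ℂ) * cchar χ (-(b * (ϖ ^ j * ξ))) * f (ϖ ^ j * ξ - 0) :=
    HasScale.weighted_ae _ _ _ _ _ _
  simpa only [sub_zero] using this

theorem fourierIntegral_congr {f g : K → ℂ} (h : f =ᵐ[μ] g) :
    Fourier.fourierIntegral χ μ f = Fourier.fourierIntegral χ μ g := by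
  ext ξ
  rw [fourierIntegral_apply, fourierIntegral_apply]
  refine integral_congr_ae ?_
  filter_upwards [h] with x hx
  rw [hx]

/-- The pair of isometries is continuous and maps the `L¹ ∩ L²` graph into itself by a change of
variables, hence also its closure. -/
theorem IsCharLattice.isL2Fourier_affine (hv : IsCharLattice χ v) {ϖ : K}
    (h : HasScale μ ϖ (resCard K)) (h0 : ϖ ≠ 0) (j : ℤ) (b : K) {f g : Lp ℂ 2 μ}
    (hfg : IsL2Fourier χ μ f g) :
    IsL2Fourier χ μ (affineLp h h0 j b f) (hv.modulatedLp h h0 j b g) := by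
  have hcont : Continuous fun z : Lp ℂ 2 μ × Lp ℂ 2 μ =>
      (affineLp h h0 j b z.1, hv.modulatedLp h h0 j b z.2) :=
    ((affineLp h h0 j b).continuous.comp continuous_fst).prodMk
      ((hv.modulatedLp h h0 j b).continuous.comp continuous_snd)
  refine map_mem_closure (f := fun z : Lp ℂ 2 μ × Lp ℂ 2 μ =>
      (affineLp h h0 j b z.1, hv.modulatedLp h h0 j b z.2)) hcont hfg ?_
  rintro ⟨f, g⟩ ⟨hf, hg⟩
  dsimp only at hf hg
  have hs := h.uniformizer_zpow h0 (-j)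
  have ha0 : ϖ ^ (-j) ≠ 0 := zpow_ne_zero _ h0
  refine ⟨?_, ?_⟩
  · exact ((hs.integrable_comp_sub (resCard_zpow_ne_top _) ha0 b hf).const_mul _).congr
      (affineLp_ae h h0 j b f).symm
  · have hq := (h.uniformizer_zpow h0 j).quasiMeasurePreserving
    filter_upwards [hv.modulatedLp_ae h h0 j b g, hq.ae hg] with ξ h1 h2
    rw [h1, h2, fourierIntegral_congr (affineLp_ae h h0 j b f), fourierIntegral_apply,
      fourierIntegral_apply]
    obtain ⟨Φ, hΦ⟩ : ∃ Φ : K → ℂ, ∀ y, Φ y =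
        (normFactor K j : ℂ) * (cchar χ (-(y * (ϖ ^ j * ξ))) * f (y - b)) := ⟨_, fun _ => rfl⟩
    have h3 : ∀ x, cchar χ (-(x * ξ)) * ((normFactor K j : ℂ) * f (ϖ ^ (-j) * x - b)) =
        Φ (ϖ ^ (-j) * x) := by
      intro x
      have : ϖ ^ (-j) * x * (ϖ ^ j * ξ) = x * ξ := by
        rw [mul_mul_mul_comm, ← zpow_add₀ h0, neg_add_cancel, zpow_zero, one_mul]
      rw [hΦ, this]
      ring
    simp only [h3]
    rw [hs.integral_comp ha0]
    simp only [hΦ]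
    rw [integral_const_mul,
      ← integral_add_right_eq_self (fun y => cchar χ (-(y * (ϖ ^ j * ξ))) * f (y - b)) b]
    have h4 : ∀ y, cchar χ (-((y + b) * (ϖ ^ j * ξ))) * f (y + b - b) =
        cchar χ (-(b * (ϖ ^ j * ξ))) * (cchar χ (-(y * (ϖ ^ j * ξ))) * f y) := by
      intro y
      rw [add_sub_cancel_right, add_mul, neg_add, AddChar.map_add_eq_mul]
      ring
    simp only [h4]
    rw [integral_const_mul, normFactor_neg_mul, Complex.real_smul]
    push_cast
    ring

end Affine

/-! ### The coefficients of the affine system on the frequency side. -/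

section Coefficients

variable {K : Type*} [Field K] [ValuativeRel K] [TopologicalSpace K] [IsNonarchimedeanLocalField K]
  [MeasurableSpace K] [BorelSpace K] {μ : Measure K} [μ.IsAddHaarMeasure]
  {χ : AddChar K Circle} {v : ℕ → K} [SecondCountableTopology K]

/-- The function on the frequency side, whose Fourier coefficients with respect to the lattice are
the coefficients of the affine system at scale `j`. -/
noncomputable def freqFun {ϖ : K} (h : HasScale μ ϖ (resCard K)) (h0 : ϖ ≠ 0) (j : ℤ)
    (θ g : Lp ℂ 2 μ) : K → ℂ :=
  fun η => affineLp h h0 j 0 g η * (starRingEnd ℂ) (θ η)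

/-- The coefficients of the affine system, on the frequency side. -/
noncomputable def freqCoeff (χ : AddChar K Circle) (v : ℕ → K) {ϖ : K}
    (h : HasScale μ ϖ (resCard K)) (h0 : ϖ ≠ 0) (j : ℤ) (θ g : Lp ℂ 2 μ) (k : ℕ) : ℂ :=
  ∫ η, freqFun h h0 j θ g η * cchar χ (v k * η) ∂μ

/-- Plancherel, then `η = ϖ ^ j * ξ`: the substitution makes the characters the same at every scale.
-/
theorem IsCharLattice.inner_affineLp (hv : IsCharLattice χ v) (hμ : μ (𝒪[K] : Set K) = 1)
    {ϖ : 𝒪[K]} (hϖ : Irreducible ϖ) (h : HasScale μ (ϖ : K) (resCard K)) (h0 : (ϖ : K) ≠ 0)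
    (j : ℤ) (k : ℕ) {ψ θ : Lp ℂ 2 μ} (hψ : IsL2Fourier χ μ ψ θ) (f : Lp ℂ 2 μ) :
    inner ℂ (affineLp h h0 j (v k) ψ) f = freqCoeff χ v h h0 j θ (hv.fourierL2 hμ hϖ f) k := by
  rw [← (hv.fourierL2 hμ hϖ).inner_map_map,
    hv.fourierL2_eq hμ hϖ (hv.isL2Fourier_affine h h0 j (v k) hψ), L2.inner_def]
  set g := hv.fourierL2 hμ hϖ f
  have hs := h.uniformizer_zpow h0 j
  have hj : ∀ j : ℤ, (ϖ : K) ^ j ≠ 0 := fun j => zpow_ne_zero _ h0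
  have hcancel : ∀ ξ, (ϖ : K) ^ (-j) * ((ϖ : K) ^ j * ξ) = ξ := fun ξ => by
    rw [← mul_assoc, ← zpow_add₀ h0, neg_add_cancel, zpow_zero, one_mul]
  obtain ⟨Φ, hΦ⟩ : ∃ Φ : K → ℂ, ∀ η, Φ η = (normFactor K (-j) : ℂ) *
      (g ((ϖ : K) ^ (-j) * η) * (starRingEnd ℂ) (θ η) * cchar χ (v k * η)) := ⟨_, fun _ => rfl⟩
  have h1 : ∫ ξ, inner ℂ (hv.modulatedLp h h0 j (v k) θ ξ) (g ξ) ∂μ =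
      ∫ ξ, Φ ((ϖ : K) ^ j * ξ) ∂μ := by
    refine integral_congr_ae ?_
    filter_upwards [hv.modulatedLp_ae h h0 j (v k) θ] with ξ hξ
    rw [RCLike.inner_apply, hξ, hΦ, map_mul, map_mul, conj_cchar, neg_neg, Complex.conj_ofReal, hcancel]
    ring
  have h2 : freqCoeff χ v h h0 j θ g k = ∫ η, (normFactor K j : ℂ) * (g ((ϖ : K) ^ (-j) * η) *
        (starRingEnd ℂ) (θ η) * cchar χ (v k * η)) ∂μ := by
    refine integral_congr_ae ?_
    filter_upwards [affineLp_ae h h0 j 0 g] with η hη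
    rw [freqFun, hη, sub_zero]
    ring
  rw [h1, hs.integral_comp (hj j), h2]
  simp only [hΦ]
  rw [integral_const_mul, integral_const_mul, Complex.real_smul,
    ← mul_assoc]
  congr 1
  have h3 := normFactor_neg_mul (K := K) (-j)
  rw [neg_neg] at h3
  rw [h3]
  push_cast
  ring

/-- The Parseval property of the affine system, on the frequency side. -/
def IsFreqParseval (χ : AddChar K Circle) (v : ℕ → K) {ϖ : K} (h : HasScale μ ϖ (resCard K))
    (h0 : ϖ ≠ 0) {L : ℕ} (θ : Fin L → Lp ℂ 2 μ) : Prop :=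
  ∀ g : Lp ℂ 2 μ, ∑' i : Fin L × ℤ, ∑' k, ‖freqCoeff χ v h h0 i.2 (θ i.1) g k‖ₑ ^ 2 = ‖g‖ₑ ^ 2

theorem isParsevalMultiwavelet_iff {p : ℕ} {c : ℕ} {ϖ : 𝒪[K]} {ε : Fin c → 𝒪[K]}
    (hv : IsCharLattice χ (u p ϖ ε)) (hμ : μ (𝒪[K] : Set K) = 1) (hϖ : Irreducible ϖ)
    (h : HasScale μ (ϖ : K) (resCard K)) (h0 : (ϖ : K) ≠ 0) {L : ℕ} {ψ θ : Fin L → Lp ℂ 2 μ}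
    (hψ : ∀ m, IsL2Fourier χ μ (ψ m) (θ m)) :
    IsParsevalMultiwavelet μ p ϖ ε ψ ↔ IsFreqParseval χ (u p ϖ ε) h h0 θ := by
  have key : ∀ (f : Lp ℂ 2 μ) (m : Fin L) (j : ℤ) (k : ℕ),
      ∫ x, f x * (starRingEnd ℂ) (dilate ϖ j (translate p ϖ ε k (ψ m)) x) ∂μ =
        freqCoeff χ (u p ϖ ε) h h0 j (θ m) (hv.fourierL2 hμ hϖ f) k := by
    intro f m j k
    rw [← hv.inner_affineLp hμ hϖ h h0 j k (hψ m), L2.inner_def]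
    refine integral_congr_ae ?_
    filter_upwards [affineLp_ae h h0 j (u p ϖ ε k) (ψ m)] with x hx
    rw [RCLike.inner_apply, hx]
    rfl
  have hsplit : ∀ f : Lp ℂ 2 μ,
      ∑' i : Fin L × ℤ × ℕ, ‖freqCoeff χ (u p ϖ ε) h h0 i.2.1 (θ i.1)
        (hv.fourierL2 hμ hϖ f) i.2.2‖ₑ ^ 2 =
      ∑' i : Fin L × ℤ, ∑' k, ‖freqCoeff χ (u p ϖ ε) h h0 i.2 (θ i.1)
        (hv.fourierL2 hμ hϖ f) k‖ₑ ^ 2 := by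
    intro f
    rw [ENNReal.tsum_prod', ENNReal.tsum_prod']
    congr 1 with m
    rw [ENNReal.tsum_prod']
  have hnorm : ∀ f : Lp ℂ 2 μ, ‖hv.fourierL2 hμ hϖ f‖ₑ = ‖f‖ₑ := fun f => by
    rw [← ofReal_norm, ← ofReal_norm, LinearIsometryEquiv.norm_map]
  constructor
  · intro hP g
    have := (hasSum_norm_sq_iff _ _).1 (hP ((hv.fourierL2 hμ hϖ).symm g))
    simp only [key] at this
    rwa [hsplit, ← hnorm, LinearIsometryEquiv.apply_symm_apply] at this
  · intro hP f
    rw [hasSum_norm_sq_iff]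
    simp only [key]
    rw [hsplit, ← hnorm]
    exact hP _

section Scale

variable {ϖ : K} (h : HasScale μ ϖ (resCard K)) (h0 : ϖ ≠ 0) (j : ℤ) {θ : Lp ℂ 2 μ} (g : Lp ℂ 2 μ)
  {W : Set K}

theorem integrable_freqFun : Integrable (freqFun h h0 j θ g) μ :=
  (Lp.memLp _).integrable_mul (Lp.memLp θ).star

theorem freqFun_ae : freqFun h h0 j θ g =ᵐ[μ] fun η =>
    (normFactor K j : ℂ) * g (ϖ ^ (-j) * η) * (starRingEnd ℂ) (θ η) := by
  filter_upwards [affineLp_ae h h0 j 0 g] with η hη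
  rw [freqFun, hη, sub_zero]

theorem memLp_freqFun (hθ : (fun ξ => ‖θ ξ‖) =ᵐ[μ] W.indicator fun _ => (1 : ℝ)) :
    MemLp (freqFun h h0 j θ g) 2 μ := by
  classical
  refine (Lp.memLp (affineLp h h0 j 0 g)).of_le (integrable_freqFun h h0 j g).aestronglyMeasurable ?_
  filter_upwards [hθ] with η hη
  rw [freqFun, norm_mul, RCLike.norm_conj, hη, Set.indicator_apply]
  split_ifs <;> simp

theorem lintegral_freqFun (hθ : (fun ξ => ‖θ ξ‖) =ᵐ[μ] W.indicator fun _ => (1 : ℝ)) :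
    ∫⁻ η, ‖freqFun h h0 j θ g η‖ₑ ^ 2 ∂μ =
      ∫⁻ ξ, {ξ | ϖ ^ j * ξ ∈ W}.indicator (fun ξ => ‖g ξ‖ₑ ^ 2) ξ ∂μ := by
  classical
  obtain ⟨Φ, hΦ⟩ : ∃ Φ : K → ℝ≥0∞, ∀ ξ, Φ ξ = (resCard K : ℝ≥0∞) ^ j *
      {ξ | ϖ ^ j * ξ ∈ W}.indicator (fun ξ => ‖g ξ‖ₑ ^ 2) ξ := ⟨_, fun _ => rfl⟩
  have h1 : ∫⁻ η, ‖freqFun h h0 j θ g η‖ₑ ^ 2 ∂μ = ∫⁻ η, Φ (ϖ ^ (-j) * η) ∂μ := by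
    refine lintegral_congr_ae ?_
    filter_upwards [hθ, freqFun_ae h h0 j g (θ := θ)] with η h1 h2
    have h3 : ‖(starRingEnd ℂ) (θ η)‖ₑ = W.indicator (fun _ => 1) η := by
      rw [← ofReal_norm, RCLike.norm_conj, h1]
      simp only [Set.indicator_apply]
      split_ifs <;> simp
    have h4 : ϖ ^ j * (ϖ ^ (-j) * η) = η := by
      rw [← mul_assoc, ← zpow_add₀ h0, add_neg_cancel, zpow_zero, one_mul]
    rw [h2, enorm_mul, enorm_mul, mul_pow, mul_pow, enorm_normFactor_sq, h3, hΦ]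
    simp only [Set.indicator_apply, Set.mem_ofPred_eq, h4]
    split_ifs <;> simp
  rw [h1, (h.uniformizer_zpow h0 (-j)).lintegral_comp (zpow_ne_zero _ h0)]
  simp only [hΦ]
  rw [lintegral_const_mul' _ _ (resCard_zpow_ne_top j), ← mul_assoc, mul_comm (_ ^ (-j)),
    resCard_zpow_mul_neg, one_mul]

theorem freqCoeff_eq_zero (hθ : (fun ξ => ‖θ ξ‖) =ᵐ[μ] W.indicator fun _ => (1 : ℝ))
    (hg : ∀ᵐ ξ ∂μ, ϖ ^ j * ξ ∈ W → g ξ = 0) (k : ℕ) : freqCoeff χ v h h0 j θ g k = 0 := by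
  classical
  have h1 : ∫⁻ η, ‖freqFun h h0 j θ g η‖ₑ ^ 2 ∂μ = 0 := by
    rw [lintegral_freqFun h h0 j g hθ, ← lintegral_zero (μ := μ)]
    refine lintegral_congr_ae ?_
    filter_upwards [hg] with ξ hξ
    simp only [Set.indicator_apply, Set.mem_ofPred_eq]
    split_ifs with hm
    · simp [hξ hm]
    · rfl
  rw [lintegral_eq_zero_iff'
    ((integrable_freqFun h h0 j g).aestronglyMeasurable.enorm.pow_const 2)] at h1
  rw [freqCoeff, ← integral_zero K ℂ (μ := μ)]
  refine integral_congr_ae ?_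
  filter_upwards [h1] with η hη
  have : freqFun h h0 j θ g η = 0 := by simpa using hη
  rw [this, zero_mul]

theorem ae_add_of_ae {P : K → Prop} (hP : ∀ᵐ x ∂μ, P x) (t : K) : ∀ᵐ x ∂μ, P (x + t) :=
  (measurePreserving_add_right μ t).quasiMeasurePreserving.ae hP

theorem IsCharLattice.tsum_freqCoeff (hv : IsCharLattice χ v) (hμ : μ (𝒪[K] : Set K) = 1)
    {ϖ₀ : 𝒪[K]} (hϖ : Irreducible ϖ₀)
    (hθ : (fun ξ => ‖θ ξ‖) =ᵐ[μ] W.indicator fun _ => (1 : ℝ))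
    (hd : ∀ l l', l ≠ l' → ∀ᵐ η ∂μ, freqFun h h0 j θ g (η + v l) = 0 ∨
      freqFun h h0 j θ g (η + v l') = 0) :
    ∑' k, ‖freqCoeff χ v h h0 j θ g k‖ₑ ^ 2 =
      ∫⁻ ξ, {ξ | ϖ ^ j * ξ ∈ W}.indicator (fun ξ => ‖g ξ‖ₑ ^ 2) ξ ∂μ := by
  rw [← lintegral_freqFun h h0 j g hθ]
  exact hv.tsum_enorm_integral_mul_sq hμ hϖ (integrable_freqFun h h0 j g)
    (memLp_freqFun h h0 j g hθ) hd

/-- Here the disjointness of translates comes from `W`, so `g` is arbitrary. -/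
theorem IsCharLattice.tsum_freqCoeff_of_disjoint (hv : IsCharLattice χ v)
    (hμ : μ (𝒪[K] : Set K) = 1) {ϖ₀ : 𝒪[K]} (hϖ : Irreducible ϖ₀)
    (hθ : (fun ξ => ‖θ ξ‖) =ᵐ[μ] W.indicator fun _ => (1 : ℝ))
    (hd : ∀ l l', l ≠ l' → ∀ᵐ η ∂μ, ¬ (η + v l ∈ W ∧ η + v l' ∈ W)) :
    ∑' k, ‖freqCoeff χ v h h0 j θ g k‖ₑ ^ 2 =
      ∫⁻ ξ, {ξ | ϖ ^ j * ξ ∈ W}.indicator (fun ξ => ‖g ξ‖ₑ ^ 2) ξ ∂μ := by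
  refine hv.tsum_freqCoeff h h0 j g hμ hϖ hθ fun l l' hl => ?_
  filter_upwards [ae_add_of_ae hθ (v l), ae_add_of_ae hθ (v l'), hd l l' hl] with η h1 h2 h3
  have key : ∀ x, ‖θ x‖ = W.indicator (fun _ => (1 : ℝ)) x → x ∉ W → freqFun h h0 j θ g x = 0 := by
    intro x hx hxW
    rw [Set.indicator_of_notMem hxW, norm_eq_zero] at hx
    rw [freqFun, hx, map_zero, mul_zero]
  rcases not_and_or.1 h3 with h3 | h3
  · exact Or.inl (key _ h1 h3)
  · exact Or.inr (key _ h2 h3)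

/-- Here the disjointness comes from `g`: multiplication by `ϖ ^ j` carries the ball into a single
coset of `𝒪`. Nothing is assumed about translates of `W`, so this is usable before (ii) is known. -/
theorem IsCharLattice.tsum_freqCoeff_of_ball (hv : IsCharLattice χ v)
    (hμ : μ (𝒪[K] : Set K) = 1) {ϖ₀ : 𝒪[K]} (hϖ : Irreducible ϖ₀)
    (hθ : (fun ξ => ‖θ ξ‖) =ᵐ[μ] W.indicator fun _ => (1 : ℝ)) {a b : K} (ha0 : a ≠ 0)
    (ha : ϖ ^ j * a⁻¹ ∈ 𝒪[K]) (hg : ∀ᵐ ξ ∂μ, ξ ∉ ballAt a b → g ξ = 0) :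
    ∑' k, ‖freqCoeff χ v h h0 j θ g k‖ₑ ^ 2 =
      ∫⁻ ξ, {ξ | ϖ ^ j * ξ ∈ W}.indicator (fun ξ => ‖g ξ‖ₑ ^ 2) ξ ∂μ := by
  refine hv.tsum_freqCoeff h h0 j g hμ hϖ hθ fun l l' hl => ?_
  have h1 : ∀ᵐ η ∂μ, ϖ ^ (-j) * η ∉ ballAt a b → freqFun h h0 j θ g η = 0 := by
    filter_upwards [freqFun_ae h h0 j g (θ := θ),
      (h.uniformizer_zpow h0 (-j)).quasiMeasurePreserving.ae hg] with η h1 h2 h3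
    rw [h1, h2 h3, mul_zero, zero_mul]
  filter_upwards [ae_add_of_ae h1 (v l), ae_add_of_ae h1 (v l')] with η h2 h3
  by_cases h4 : ϖ ^ (-j) * (η + v l) ∈ ballAt a b
  · by_cases h5 : ϖ ^ (-j) * (η + v l') ∈ ballAt a b
    · refine absurd (hv.eq_of_sub_mem l l' ?_) hl
      have := mul_mem ha (sub_mem (mem_ballAt.1 h4) (mem_ballAt.1 h5))
      convert this using 1
      rw [zpow_neg]
      have := zpow_ne_zero j h0
      field_simp
      ring
    · exact Or.inr (h3 h5)
  · exact Or.inl (h2 h4)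

end Scale

end Coefficients

/-! ### Parseval property and tilings. -/

section Characterization

variable {K : Type*} [Field K] [ValuativeRel K] [TopologicalSpace K] [IsNonarchimedeanLocalField K]
  [MeasurableSpace K] [BorelSpace K] {μ : Measure K} [μ.IsAddHaarMeasure]
  {χ : AddChar K Circle} {v : ℕ → K} [SecondCountableTopology K]

/-- The set `ϖ ^ (-j) * W m`, for `i = (m, j)`. -/
def scaledSet (ϖ : K) {L : ℕ} (W : Fin L → Set K) (i : Fin L × ℤ) : Set K :=
  {ξ | ϖ ^ i.2 * ξ ∈ W i.1}

theorem measurableSet_scaledSet (ϖ : K) {L : ℕ} {W : Fin L → Set K}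
    (hW : ∀ m, MeasurableSet (W m)) (i : Fin L × ℤ) : MeasurableSet (scaledSet ϖ W i) :=
  (hW i.1).preimage (by fun_prop : Measurable fun ξ => ϖ ^ i.2 * ξ)

theorem measure_ballAt_lt_top {a : K} (ha : a ≠ 0) (b : K) : μ (ballAt a b) < ⊤ := by
  have : ballAt a b = (fun x => x + -(a⁻¹ * b)) ⁻¹' (fracIdeal a : Set K) := by
    ext x
    rw [Set.mem_preimage, SetLike.mem_coe, mem_fracIdeal, mem_ballAt, mul_add, mul_neg,
      mul_inv_cancel_left₀ ha, sub_eq_add_neg]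
  rw [this, measure_preimage_add_right]
  exact (isCompact_fracIdeal ha).measure_lt_top

theorem measure_eq_zero_of_inter_ballAt (hv : IsCharLattice χ v) (a : K) {S : Set K}
    (h : ∀ l, μ (S ∩ ballAt a (v l)) = 0) : μ S = 0 := by
  rw [← Set.inter_univ S, ← hv.iUnion_ballAt a, Set.inter_iUnion]
  exact measure_iUnion_null h

theorem enorm_indicatorConstLp_sq {E : Set K} (hE : MeasurableSet E) (hE' : μ E ≠ ⊤) :
    ‖(indicatorConstLp 2 hE hE' (1 : ℂ) : Lp ℂ 2 μ)‖ₑ ^ 2 = μ E := by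
  classical
  rw [enorm_sq_eq_lintegral, ← lintegral_indicator_one hE]
  refine lintegral_congr_ae ?_
  filter_upwards [indicatorConstLp_coeFn (p := 2) (hs := hE) (hμs := hE') (c := (1 : ℂ))] with x hx
  rw [hx]
  simp only [Set.indicator_apply]
  split_ifs <;> simp

variable {ϖ : 𝒪[K]} (h : HasScale μ (ϖ : K) (resCard K)) (h0 : (ϖ : K) ≠ 0)
  {L : ℕ} {θ : Fin L → Lp ℂ 2 μ} {W : Fin L → Set K}

theorem isFreqParseval_of_tiling (hv : IsCharLattice χ v) (hμ : μ (𝒪[K] : Set K) = 1)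
    (hϖ : Irreducible ϖ) (hW : ∀ m, MeasurableSet (W m))
    (hθ : ∀ m, (fun ξ => ‖θ m ξ‖) =ᵐ[μ] (W m).indicator fun _ => (1 : ℝ))
    (hdisj : ∀ i i', i ≠ i' → μ (scaledSet (ϖ : K) W i ∩ scaledSet (ϖ : K) W i') = 0)
    (hcover : ∀ᵐ ξ ∂μ, ∃ i, ξ ∈ scaledSet (ϖ : K) W i)
    (htrans : ∀ m l l', l ≠ l' → ∀ᵐ η ∂μ, ¬ (η + v l ∈ W m ∧ η + v l' ∈ W m)) :
    IsFreqParseval χ v h h0 θ := by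
  classical
  intro g
  have h1 : ∀ i : Fin L × ℤ, ∑' k, ‖freqCoeff χ v h h0 i.2 (θ i.1) g k‖ₑ ^ 2 =
      ∫⁻ ξ, (scaledSet (ϖ : K) W i).indicator (fun ξ => ‖g ξ‖ₑ ^ 2) ξ ∂μ := fun i =>
    hv.tsum_freqCoeff_of_disjoint h h0 i.2 g hμ hϖ (hθ i.1) (htrans i.1)
  simp only [h1]
  rw [← lintegral_tsum fun i => AEMeasurable.indicator
    ((Lp.aestronglyMeasurable g).enorm.pow_const 2) (measurableSet_scaledSet _ hW i),
    enorm_sq_eq_lintegral]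
  have h2 : ∀ᵐ ξ ∂μ, ∀ i i', i ≠ i' →
      ¬ (ξ ∈ scaledSet (ϖ : K) W i ∧ ξ ∈ scaledSet (ϖ : K) W i') := by
    simp only [ae_all_iff]
    intro i i' hi
    exact measure_eq_zero_iff_ae_notMem.1 (hdisj i i' hi)
  refine lintegral_congr_ae ?_
  filter_upwards [h2, hcover] with ξ h3 h4
  obtain ⟨i, hi⟩ := h4
  rw [tsum_eq_single i, Set.indicator_of_mem hi]
  intro i' hi'
  rw [Set.indicator_of_notMem]
  exact fun h5 => h3 i' i hi' ⟨h5, hi⟩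

theorem IsFreqParseval.eq_zero (hP : IsFreqParseval χ v h h0 θ) {g : Lp ℂ 2 μ}
    (hg : ∀ (i : Fin L × ℤ) k, freqCoeff χ v h h0 i.2 (θ i.1) g k = 0) : g = 0 := by
  have := hP g
  simp only [hg, enorm_zero, ne_eq, OfNat.ofNat_ne_zero, not_false_eq_true, zero_pow,
    tsum_zero] at this
  rw [eq_comm, pow_eq_zero_iff two_ne_zero, enorm_eq_zero] at this
  exact this

/-- A function supported off every scaled set has only zero coefficients; the test functions are
indicators of bounded pieces of the uncovered set. -/
theorem IsFreqParseval.ae_mem_scaledSet (hP : IsFreqParseval χ v h h0 θ)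
    (hv : IsCharLattice χ v) (hW : ∀ m, MeasurableSet (W m))
    (hθ : ∀ m, (fun ξ => ‖θ m ξ‖) =ᵐ[μ] (W m).indicator fun _ => (1 : ℝ)) :
    ∀ᵐ ξ ∂μ, ∃ i, ξ ∈ scaledSet (ϖ : K) W i := by
  have hN : MeasurableSet (⋃ i, scaledSet (ϖ : K) W i)ᶜ :=
    (MeasurableSet.iUnion fun i => measurableSet_scaledSet _ hW i).compl
  suffices μ (⋃ i, scaledSet (ϖ : K) W i)ᶜ = 0 by
    filter_upwards [measure_eq_zero_iff_ae_notMem.1 this] with ξ hξ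
    simpa using hξ
  refine measure_eq_zero_of_inter_ballAt hv 1 fun l => ?_
  have hE := hN.inter (measurableSet_ballAt 1 (v l))
  have hE' : μ ((⋃ i, scaledSet (ϖ : K) W i)ᶜ ∩ ballAt 1 (v l)) ≠ ⊤ :=
    ((measure_mono Set.inter_subset_right).trans_lt
      (measure_ballAt_lt_top one_ne_zero (v l))).ne
  suffices hz : (indicatorConstLp 2 hE hE' (1 : ℂ) : Lp ℂ 2 μ) = 0 by
    rw [← enorm_indicatorConstLp_sq hE hE', hz, enorm_zero, zero_pow two_ne_zero]
  refine hP.eq_zero h h0 fun i k => ?_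
  refine freqCoeff_eq_zero h h0 i.2 _ (hθ i.1) ?_ k
  filter_upwards [indicatorConstLp_coeFn (p := 2) (hs := hE) (hμs := hE') (c := (1 : ℂ))] with x hx
  intro hxi
  rw [hx, Set.indicator_of_notMem]
  exact fun hx' => hx'.1 (Set.mem_iUnion.2 ⟨i, hxi⟩)

theorem IsFreqParseval.measure_inter_scaledSet (hP : IsFreqParseval χ v h h0 θ)
    (hv : IsCharLattice χ v) (hμ : μ (𝒪[K] : Set K) = 1) (hϖ : Irreducible ϖ)
    (hW : ∀ m, MeasurableSet (W m))
    (hθ : ∀ m, (fun ξ => ‖θ m ξ‖) =ᵐ[μ] (W m).indicator fun _ => (1 : ℝ))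
    {i i' : Fin L × ℤ} (hi : i ≠ i') :
    μ (scaledSet (ϖ : K) W i ∩ scaledSet (ϖ : K) W i') = 0 := by
  classical
  -- Balls `ϖ ^ n * (b + 𝒪)` with `n` this large are carried into a single coset of `𝒪` at both
  -- scales.
  obtain ⟨n, hn, hn'⟩ : ∃ n : ℤ, 0 ≤ i.2 + n ∧ 0 ≤ i'.2 + n :=
    ⟨|i.2| + |i'.2|, by have := neg_abs_le i.2; have := abs_nonneg i'.2; omega,
      by have := neg_abs_le i'.2; have := abs_nonneg i.2; omega⟩
  have ha0 : (ϖ : K) ^ (-n) ≠ 0 := zpow_ne_zero _ h0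
  have ha : ∀ j : ℤ, 0 ≤ j + n → (ϖ : K) ^ j * ((ϖ : K) ^ (-n))⁻¹ ∈ 𝒪[K] := by
    intro j hj
    rw [zpow_neg, inv_inv, ← zpow_add₀ h0]
    obtain ⟨d, hd⟩ := Int.eq_ofNat_of_zero_le hj
    rw [hd, zpow_natCast]
    exact pow_mem ϖ.2 d
  refine measure_eq_zero_of_inter_ballAt hv ((ϖ : K) ^ (-n)) fun l => ?_
  set E := scaledSet (ϖ : K) W i ∩ scaledSet (ϖ : K) W i' ∩ ballAt ((ϖ : K) ^ (-n)) (v l)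
  have hE : MeasurableSet E := ((measurableSet_scaledSet _ hW i).inter
    (measurableSet_scaledSet _ hW i')).inter (measurableSet_ballAt _ _)
  have hE' : μ E ≠ ⊤ := ((measure_mono Set.inter_subset_right).trans_lt
    (measure_ballAt_lt_top ha0 (v l))).ne
  set g : Lp ℂ 2 μ := indicatorConstLp 2 hE hE' (1 : ℂ)
  have hg : ∀ᵐ x ∂μ, g x = E.indicator (fun _ => (1 : ℂ)) x := indicatorConstLp_coeFn
  have hball : ∀ᵐ ξ ∂μ, ξ ∉ ballAt ((ϖ : K) ^ (-n)) (v l) → g ξ = 0 := by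
    filter_upwards [hg] with ξ h1 h2
    rw [h1, Set.indicator_of_notMem fun h3 => h2 h3.2]
  have hterm : ∀ i₀ : Fin L × ℤ, 0 ≤ i₀.2 + n → E ⊆ scaledSet (ϖ : K) W i₀ →
      ∑' k, ‖freqCoeff χ v h h0 i₀.2 (θ i₀.1) g k‖ₑ ^ 2 = μ E := by
    intro i₀ hi₀ hsub
    rw [hv.tsum_freqCoeff_of_ball h h0 i₀.2 g hμ hϖ (hθ i₀.1) ha0 (ha _ hi₀) hball,
      ← lintegral_indicator_one hE]
    refine lintegral_congr_ae ?_
    filter_upwards [hg] with ξ h1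
    by_cases hξ : ξ ∈ E
    · rw [Set.indicator_of_mem (show ξ ∈ {ξ | (ϖ : K) ^ i₀.2 * ξ ∈ W i₀.1} from hsub hξ), h1,
        Set.indicator_of_mem hξ, Set.indicator_of_mem hξ]
      simp
    · rw [Set.indicator_of_notMem hξ]
      simp only [Set.indicator_apply]
      rw [h1, Set.indicator_of_notMem hξ]
      simp
  -- The two indices each contribute `μ E`, while the full sum is only `μ E`.
  have hle : ∑ i₀ ∈ {i, i'}, ∑' k, ‖freqCoeff χ v h h0 i₀.2 (θ i₀.1) g k‖ₑ ^ 2 ≤ μ E := by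
    refine (ENNReal.sum_le_tsum _).trans_eq ?_
    rw [hP g, enorm_indicatorConstLp_sq]
  rw [Finset.sum_pair hi, hterm i hn fun x hx => hx.1.1, hterm i' hn' fun x hx => hx.1.2] at hle
  by_contra hne
  exact absurd (ENNReal.lt_add_right hE' hne) (not_lt.2 hle)

/-- The function equal to `θ m` on `E` and `-θ m` on `E + s` has zero coefficients: at `(m, 0)` the
two halves cancel because `χ (v k * s) = 1`, and elsewhere disjointness of the scaled sets applies.
So it is zero, although it has modulus `1` on `E`. -/
theorem IsFreqParseval.ae_not_mem_translates (hP : IsFreqParseval χ v h h0 θ)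
    (hv : IsCharLattice χ v) (hW : ∀ m, MeasurableSet (W m))
    (hθ : ∀ m, (fun ξ => ‖θ m ξ‖) =ᵐ[μ] (W m).indicator fun _ => (1 : ℝ))
    (hdisj : ∀ i i', i ≠ i' → μ (scaledSet (ϖ : K) W i ∩ scaledSet (ϖ : K) W i') = 0)
    (m : Fin L) {l l' : ℕ} (hl : l ≠ l') : ∀ᵐ η ∂μ, ¬ (η + v l ∈ W m ∧ η + v l' ∈ W m) := by
  classical
  set s := v l' - v l
  have hs : s ∉ 𝒪[K] := fun hs => hl (hv.eq_of_sub_mem _ _ hs).symm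
  suffices hnull : μ {ξ | ξ ∈ W m ∧ ξ + s ∈ W m} = 0 by
    filter_upwards [ae_add_of_ae (measure_eq_zero_iff_ae_notMem.1 hnull) (v l)] with η hη
    intro h1
    refine hη ⟨h1.1, ?_⟩
    convert h1.2 using 1
    simp only [s]
    ring
  -- Inside one coset of `𝒪` the piece `E` is disjoint from `E + s`, since `s ∉ 𝒪`.
  refine measure_eq_zero_of_inter_ballAt hv 1 fun r => ?_
  set E := {ξ | ξ ∈ W m ∧ ξ + s ∈ W m} ∩ ballAt 1 (v r)
  set E' := (fun ξ => ξ - s) ⁻¹' E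
  have hE : MeasurableSet E := ((hW m).inter ((hW m).preimage
    (by fun_prop : Measurable fun ξ => ξ + s))).inter (measurableSet_ballAt _ _)
  have hE' : MeasurableSet E' := hE.preimage (by fun_prop : Measurable fun ξ => ξ - s)
  have hEW : E ⊆ W m := fun x hx => hx.1.1
  have hEW' : E' ⊆ W m := fun x hx => by simpa using hx.1.2
  have hEE' : ∀ x ∈ E, x ∉ E' := by
    intro x hx hx'
    apply hs
    simpa using sub_mem (mem_ballAt_one.1 hx.2) (mem_ballAt_one.1 hx'.2)
  set g₀ : K → ℂ := fun ξ => E.indicator (θ m) ξ - E'.indicator (θ m) ξ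
  have hg₀ : MemLp g₀ 2 μ := ((Lp.memLp (θ m)).indicator hE).sub ((Lp.memLp (θ m)).indicator hE')
  have hgae : ∀ᵐ ξ ∂μ, (hg₀.toLp : Lp ℂ 2 μ) ξ = g₀ ξ := hg₀.coeFn_toLp
  have hg₀W : ∀ ξ, ξ ∉ W m → g₀ ξ = 0 := by
    intro ξ hξ
    simp only [g₀]
    rw [Set.indicator_of_notMem fun h => hξ (hEW h), Set.indicator_of_notMem fun h => hξ (hEW' h),
      sub_zero]
  have hzero : (hg₀.toLp : Lp ℂ 2 μ) = 0 := by
    refine hP.eq_zero h h0 fun i k => ?_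
    by_cases hi : i = (m, 0)
    · subst hi
      have hint : ∀ {F : Set K}, MeasurableSet F → F ⊆ W m → Integrable
          (F.indicator fun η => cchar χ (v k * η)) μ := by
        intro F hF hFW
        have hfin : μ F ≠ ⊤ := by
          refine ((measure_mono hFW).trans_lt ?_).ne
          have h2 : μ (W m) = ‖θ m‖ₑ ^ 2 := by
            rw [enorm_sq_eq_lintegral, ← lintegral_indicator_one (hW m)]
            refine lintegral_congr_ae ?_
            filter_upwards [hθ m] with ξ hξ
            rw [← ofReal_norm, hξ]
            simp only [Set.indicator_apply]
            split_ifs <;> simp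
          rw [h2]
          exact ENNReal.pow_lt_top enorm_lt_top
        exact memLp_one_iff_integrable.1 (memLp_indicator_of_norm_le hF hfin
          (hv.continuous_cchar.comp (by fun_prop : Continuous fun η => v k * η)).measurable
          (fun x => (norm_cchar χ _).le) 1)
      have h1 : freqCoeff χ v h h0 0 (θ m) (hg₀.toLp) k =
          ∫ η, E.indicator (fun η => cchar χ (v k * η)) η -
            E'.indicator (fun η => cchar χ (v k * η)) η ∂μ := by
        refine integral_congr_ae ?_
        filter_upwards [freqFun_ae h h0 0 hg₀.toLp (θ := θ m), hgae, hθ m] with η h1 h2 h3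
        rw [h1, neg_zero, zpow_zero, one_mul, h2]
        have h4 : η ∈ W m → θ m η * (starRingEnd ℂ) (θ m η) = 1 := by
          intro hη
          rw [Complex.mul_conj, Complex.normSq_eq_norm_sq, h3, Set.indicator_of_mem hη]
          simp
        have h5 : (normFactor K 0 : ℂ) = 1 := by simp [normFactor]
        rw [h5, one_mul]
        have h6 : ∀ F : Set K, F ⊆ W m → F.indicator (θ m) η * (starRingEnd ℂ) (θ m η) *
            cchar χ (v k * η) = F.indicator (fun η => cchar χ (v k * η)) η := by
          intro F hF
          simp only [Set.indicator_apply]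
          split_ifs with hη
          · rw [h4 (hF hη), one_mul]
          · simp
        rw [← h6 E hEW, ← h6 E' hEW']
        simp only [g₀]
        ring
      rw [h1, integral_sub (hint hE hEW) (hint hE' hEW'),
        ← integral_add_right_eq_self (E'.indicator fun η => cchar χ (v k * η)) s, sub_eq_zero]
      congr 1 with η
      have h2 : η + s ∈ E' ↔ η ∈ E := by
        simp only [E', Set.mem_preimage, add_sub_cancel_right]
      simp only [Set.indicator_apply, h2]
      have h3 : cchar χ (v k * s) = 1 := by
        rw [show v k * s = v k * v l' - v k * v l by simp only [s]; ring,
          AddChar.map_sub_eq_div, hv.cchar_mul, hv.cchar_mul, div_one]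
      rw [mul_add, AddChar.map_add_eq_mul, h3, mul_one]
    · refine freqCoeff_eq_zero h h0 i.2 _ (hθ i.1) ?_ k
      filter_upwards [measure_eq_zero_iff_ae_notMem.1 (hdisj i (m, 0) hi), hgae] with ξ h1 h2 h3
      rw [h2]
      refine hg₀W ξ fun h4 => h1 ⟨h3, ?_⟩
      simpa [scaledSet] using h4
  rw [measure_eq_zero_iff_ae_notMem]
  filter_upwards [hgae, hθ m, (Lp.eq_zero_iff_ae_eq_zero).1 hzero] with ξ h1 h2 h3 h4
  rw [h1, Pi.zero_apply] at h3
  simp only [g₀] at h3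
  rw [Set.indicator_of_mem h4, Set.indicator_of_notMem (hEE' ξ h4), sub_zero] at h3
  rw [h3, Set.indicator_of_mem (hEW h4), norm_zero] at h2
  exact zero_ne_one h2

theorem dilateSet_eq {ϖ : K} (h0 : ϖ ≠ 0) (j : ℤ) (S : Set K) :
    dilateSet ϖ j S = {ξ | ϖ ^ (-j) * ξ ∈ S} := by
  ext x
  have hj := zpow_ne_zero j h0
  constructor
  · rintro ⟨y, hy, rfl⟩
    simpa [zpow_neg, inv_mul_cancel_left₀ hj] using hy
  · intro hx
    exact ⟨_, hx, by simp [zpow_neg, mul_inv_cancel_left₀ hj]⟩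

theorem translateSet_eq (a : K) (S : Set K) : translateSet a S = {ξ | ξ - a ∈ S} := by
  ext x
  constructor
  · rintro ⟨y, hy, rfl⟩
    simpa using hy
  · intro hx
    exact ⟨_, hx, by simp⟩

theorem dilateSet_iUnion {ϖ : K} (h0 : ϖ ≠ 0) (j : ℤ) (W : Fin L → Set K) :
    dilateSet ϖ j (⋃ m, W m) = ⋃ m, scaledSet ϖ W (m, -j) := by
  rw [dilateSet_eq h0]
  ext x
  simp [scaledSet]

/-- Both halves of (i) merge into one tiling indexed by pairs `(m, j)`. The sign of `j` flips
because `scaledSet` is a preimage and `dilateSet` an image. -/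
theorem scaling_partition_iff (h : HasScale μ (ϖ : K) (resCard K)) (h0 : (ϖ : K) ≠ 0)
    (hW : ∀ m, MeasurableSet (W m)) :
    ((∀ m m', m ≠ m' → μ (W m ∩ W m') = 0) ∧
      IsMeasurablePartition μ (fun j : ℤ => dilateSet (ϖ : K) j (⋃ m, W m)) Set.univ) ↔
    (∀ i i', i ≠ i' → μ (scaledSet (ϖ : K) W i ∩ scaledSet (ϖ : K) W i') = 0) ∧
      ∀ᵐ ξ ∂μ, ∃ i, ξ ∈ scaledSet (ϖ : K) W i := by
  have hscaled0 : ∀ m, scaledSet (ϖ : K) W (m, 0) = W m := fun m => by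
    ext; simp [scaledSet]
  constructor
  · rintro ⟨hWd, -, hd, hU⟩
    refine ⟨?_, ?_⟩
    · rintro ⟨m, j⟩ ⟨m', j'⟩ hi
      by_cases hj : j = j'
      · subst hj
        have hm : m ≠ m' := fun hm => hi (by rw [hm])
        exact (h.uniformizer_zpow h0 j).quasiMeasurePreserving.preimage_null (hWd m m' hm)
      · refine measure_mono_null ?_ (hd (-j) (-j') (by simpa using hj))
        dsimp only
        rw [dilateSet_iUnion h0, dilateSet_iUnion h0, neg_neg, neg_neg]
        exact Set.inter_subset_inter (Set.subset_iUnion (fun m => scaledSet (ϖ : K) W (m, j)) m)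
          (Set.subset_iUnion (fun m => scaledSet (ϖ : K) W (m, j')) m')
    · filter_upwards [hU.mem_iff] with ξ hξ
      obtain ⟨j, hj⟩ := Set.mem_iUnion.1 (hξ.2 trivial)
      rw [dilateSet_iUnion h0] at hj
      obtain ⟨m, hm⟩ := Set.mem_iUnion.1 hj
      exact ⟨_, hm⟩
  · rintro ⟨hd, hU⟩
    refine ⟨fun m m' hm => ?_, fun j => ?_, fun j j' hj => ?_, ?_⟩
    · rw [← hscaled0 m, ← hscaled0 m']
      exact hd _ _ (by simpa using hm)
    · dsimp only
      rw [dilateSet_iUnion h0]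
      exact MeasurableSet.iUnion fun m => measurableSet_scaledSet _ hW _
    · dsimp only
      rw [dilateSet_iUnion h0, dilateSet_iUnion h0, Set.iUnion_inter]
      refine measure_iUnion_null fun m => ?_
      rw [Set.inter_iUnion]
      exact measure_iUnion_null fun m' => hd _ _ (by simp [hj])
    · rw [eventuallyEq_univ]
      filter_upwards [hU] with ξ hξ
      obtain ⟨⟨m, j⟩, hi⟩ := hξ
      refine Set.mem_iUnion.2 ⟨-j, ?_⟩
      rw [dilateSet_iUnion h0, neg_neg]
      exact Set.mem_iUnion.2 ⟨m, hi⟩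

theorem translation_partition_iff {S : Set K} (hS : MeasurableSet S) :
    (∃ T : Set K, MeasurableSet T ∧
      IsMeasurablePartition μ (fun k : ℕ => translateSet (v k) S) T) ↔
    ∀ l l', l ≠ l' → ∀ᵐ η ∂μ, ¬ (η + v l ∈ S ∧ η + v l' ∈ S) := by
  have hm : ∀ k, MeasurableSet (translateSet (v k) S) := by
    intro k
    rw [translateSet_eq]
    exact hS.preimage (by fun_prop : Measurable fun ξ => ξ - v k)
  have key : ∀ l l', μ (translateSet (v l) S ∩ translateSet (v l') S) = 0 ↔
      ∀ᵐ η ∂μ, ¬ (η + v l ∈ S ∧ η + v l' ∈ S) := by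
    intro l l'
    -- Shifting by `v l + v l'` exchanges the two conditions and turns `η - v l` into `η + v l'`, so
    -- no negated lattice points are needed.
    rw [← measure_preimage_add_right μ (v l + v l') (translateSet (v l) S ∩ translateSet (v l') S),
      measure_eq_zero_iff_ae_notMem]
    refine eventually_congr (Eventually.of_forall fun η => not_congr ?_)
    rw [translateSet_eq, translateSet_eq, Set.mem_preimage, Set.mem_inter_iff, Set.mem_ofPred_eq,
      Set.mem_ofPred_eq, ← add_assoc, add_sub_cancel_right, add_right_comm, add_sub_cancel_right,
      and_comm]
  constructor
  · rintro ⟨T, -, -, hd, -⟩ l l' hl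
    exact (key l l').1 (hd l l' hl)
  · intro hd
    exact ⟨_, MeasurableSet.iUnion hm, hm, fun l l' hl => (key l l').2 (hd l l' hl), EventuallyEq.rfl⟩

end Characterization

end LFPC

/-! ### Assembly of the characterization. -/

theorem proposition4p1
    {K : Type*} [Field K] [ValuativeRel K] [TopologicalSpace K] [IsNonarchimedeanLocalField K]
    (p : ℕ) [Fact p.Prime] [CharP K p]
    [MeasurableSpace K] [BorelSpace K]
    -- the Haar measure of the additive group, normalized on the ring of integers
    (μ : Measure K) [μ.IsAddHaarMeasure] (hμ : μ (𝒪[K] : Set K) = 1)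
    -- a prime element, and representatives of a basis of the residue field
    (ϖ : 𝒪[K]) (hϖ : Irreducible ϖ)
    (c : ℕ) [NeZero c] (ε : Fin c → 𝒪[K]) (hε0 : ε 0 = 1) (hε : LFPC.IsResidueBasis p ε)
    (χ : AddChar K Circle) (hχ : LFPC.IsNormalizedCharacter p ϖ ε χ)
    (L : ℕ) (ψ ψhat : Fin L → Lp ℂ 2 μ) (hψ : ∀ m, LFPC.IsL2Fourier χ μ (ψ m) (ψhat m))
    (W : Fin L → Set K) (hW : ∀ m, MeasurableSet (W m))
    (hψW : ∀ m, (fun ξ => ‖ψhat m ξ‖) =ᵐ[μ] (W m).indicator (fun _ => (1 : ℝ))) :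
    (LFPC.IsParsevalMultiwavelet μ p ϖ ε ψ ↔
      ((∀ m m', m ≠ m' → μ (W m ∩ W m') = 0) ∧
        LFPC.IsMeasurablePartition μ
          (fun j : ℤ => LFPC.dilateSet (ϖ : K) j (⋃ m, W m)) Set.univ) ∧
      (∀ m, ∃ S : Set K, MeasurableSet S ∧
        LFPC.IsMeasurablePartition μ
          (fun k : ℕ => LFPC.translateSet (LFPC.u p ϖ ε k) (W m)) S)) ∧
    (LFPC.IsParsevalMultiwavelet μ p ϖ ε ψ →
      ∀ (j : ℤ) (m m' : Fin L), m ≠ m' →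
        μ (LFPC.dilateSet (ϖ : K) j (W m) ∩ W m') = 0) := by
  have hv := LFPC.isCharLattice_u hϖ hε hχ
  have : SecondCountableTopology K := LFPC.secondCountableTopology hϖ hv.exists_sub_mem
  have h := LFPC.hasScale_uniformizer μ hϖ hε hμ
  have h0 := LFPC.ϖ_ne_zero hϖ
  rw [LFPC.isParsevalMultiwavelet_iff hv hμ hϖ h h0 hψ, LFPC.scaling_partition_iff h h0 hW]
  have hdisj : LFPC.IsFreqParseval χ (LFPC.u p ϖ ε) h h0 ψhat → ∀ i i', i ≠ i' →
      μ (LFPC.scaledSet (ϖ : K) W i ∩ LFPC.scaledSet (ϖ : K) W i') = 0 :=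
    fun hP _ _ hi => hP.measure_inter_scaledSet h h0 hv hμ hϖ hW hψW hi
  refine ⟨⟨fun hP => ⟨⟨hdisj hP, hP.ae_mem_scaledSet h h0 hv hW hψW⟩, fun m => ?_⟩, ?_⟩, ?_⟩
  · exact (LFPC.translation_partition_iff (hW m)).2 fun l l' hl =>
      hP.ae_not_mem_translates h h0 hv hW hψW (hdisj hP) m hl
  · rintro ⟨⟨hd, hU⟩, ht⟩
    exact LFPC.isFreqParseval_of_tiling h h0 hv hμ hϖ hW hψW hd hU fun m =>
      (LFPC.translation_partition_iff (hW m)).1 (ht m)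
  · intro hP j m m' hm
    -- `ϖ ^ j * W m` and `W m'` are the scaled sets at `(m, -j)` and `(m', 0)`.
    have := hdisj hP (m, -j) (m', 0) (by simp [hm])
    rw [LFPC.dilateSet_eq h0]
    simpa [LFPC.scaledSet] using this
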